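/- Conventions. An ellipsoid in $\mathbb{R}^n$ with center $c$ is a set $\xi=M(\mathbb{B}^n)+c$, where $\mathbb{B}^n$ is the closed Euclidean unit ball and $M$ is a nonsingular real $n\times n$ matrix; for $\lambda>0$ put $\lambda\cdot\xi=\lambda(\xi-c)+c$. $|\cdot|$ is (outer) Lebesgue measure and $\|A\|=\max_{|x|=1}|Ax|$. A family $\Theta=\{\theta_{x,t}:x\in\mathbb{R}^n,\ t\in\mathbb{R}\}$ of ellipsoids $\theta_{x,t}=M_{x,t}(\mathbb{B}^n)+x$ is a *continuous ellipsoid cover* if there are constants $a_1,\dots,a_6>0$ such that $a_12^{-t}\le|\theta_{x,t}|\le a_22^{-t}$ for all $x,t$, and, for all $x,y\in\mathbb{R}^n$, $t\in\mathbb{R}$, $s\ge0$ with $\theta_{x,t}\cap\theta_{y,t+s}\ne\emptyset$, $$a_32^{-a_4s}\le 1/\|M_{y,t+s}^{-1}M_{x,t}\|\le\|M_{x,t}^{-1}M_{y,t+s}\|\le a_52^{-a_6s}.$$ Put $\rho_\Theta(x,y)=\inf\{|\theta|:\theta\in\Theta,\ x,y\in\theta\}$. Two covers $\Theta,\Theta'$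 are *equivalent* if there is $C\ge1$ with $\theta_{x,t}\subseteq C\cdot\theta'_{x,t}$ and $\theta'_{x,t}\subseteq C\cdot\theta_{x,t}$ for all $x,t$. A *quasi-distance* is a function $\rho:\mathbb{R}^n\times\mathbb{R}^n\to[0,\infty)$ with $\rho(x,y)=0\Leftrightarrow x=y$, $\rho(x,y)=\rho(y,x)$, and, for some $\kappa\ge1$, $\rho(x,z)\le\kappa(\rho(x,y)+\rho(y,z))$ for all $x,y,z$. Put $B_\rho(x,r)=\{y:\rho(x,y)<r\}$. Quasi-distances $\rho,\rho'$ are *equivalent* if $C^{-1}\rho\le\rho'\le C\rho$ for some $C\ge1$. A quasi-distance $\rho$ is *$1$-Ahlfors-regular* if there is $c\ge1$ with $r/c\le|B_\rho(x,r)|\le cr$ for all $x\in\mathbb{R}^n$, $r>0$. It is *quasi-convex* if there is $Q\ge1$ such that for all $x\in\mathbb{R}^n$, $r>0$ there is an ellipsoid $\xi_x^r$ with center $x$ and $\xi_x^r\subseteq B_\rho(x,r)\subseteq Q\cdot\xi_x^r$. A family $\Xi_\rho=\{\xi_x^r:x\in\mathbb{R}^n,\ r>0\}$ of ellipsoids chosen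 in this way (with one $Q$ for all $x$ and $r$) is said to *correspond* to $\rho$; it is indexed by $t\in\mathbb{R}$ through $\theta_{x,t}=\xi_x^{r}$, $r=2^{-t}$. **Theorem 4.9.** (i) For any continuous ellipsoid cover $\Theta$ of $\mathbb{R}^n$, the function $\rho_\Theta$ is a quasi-distance, its balls are Lebesgue measurable, and it is quasi-convex and $1$-Ahlfors-regular. (ii) Conversely, let $\rho$ be a quasi-convex and $1$-Ahlfors-regular quasi-distance on $\mathbb{R}^n$. Then families $\Xi_\rho$ corresponding to $\rho$ exist, and every such family $\Xi=\Xi_\rho$ is a continuous ellipsoid cover whose induced quasi-distance $\rho_\Xi$ is equivalent to $\rho$. Together these give a one-to-one correspondence: there is a bijection from the set of equivalence classes of continuous ellipsoid covers of $\mathbb{R}^n$ onto the set of equivalence classes of quasi-convex, $1$-Ahlfors-regular quasi-distances on $\mathbb{R}^n$ that maps the class of $\Theta$ to the class of $\rho_\Theta$ for every $\Theta$, and whose inverse maps the class of $\rho$ to the class of $\Xi_\rho$ for every $\rho$ and every family $\Xi_\rho$ corresponding to $\rho$. -/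

import Mathlib

open MeasureTheory

namespace EllipsoidCover

noncomputable section

/-- `ℝⁿ` with the Euclidean norm and the Lebesgue measure. -/
abbrev E (n : ℕ) : Type := EuclideanSpace ℝ (Fin n)

/-- The matrix norm `‖A‖ = max_{|x| = 1} |A x|` for the Euclidean norm of `ℝⁿ`. -/
def matNorm {n : ℕ} (A : Matrix (Fin n) (Fin n) ℝ) : ℝ :=
  ‖Matrix.toEuclideanCLM (n := Fin n) (𝕜 := ℝ) A‖

/-- The set `M(𝔹ⁿ) + c`, where `𝔹ⁿ` is the closed Euclidean unit ball. -/
def ellipsoid {n : ℕ} (M : Matrix (Fin n) (Fin n) ℝ) (c : E n) : Set (E n) :=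
  (fun y => Matrix.toEuclideanCLM (n := Fin n) (𝕜 := ℝ) M y + c) '' Metric.closedBall 0 1

/-- `ξ` is an ellipsoid with center `c`. -/
def IsEllipsoidAt {n : ℕ} (c : E n) (ξ : Set (E n)) : Prop :=
  ∃ M : Matrix (Fin n) (Fin n) ℝ, M.det ≠ 0 ∧ ξ = ellipsoid M c

/-- The dilate `lam · ξ = lam (ξ - c) + c` of a set `ξ` with respect to the point `c`. -/
def dilate {n : ℕ} (c : E n) (lam : ℝ) (ξ : Set (E n)) : Set (E n) :=
  (fun y => lam • (y - c) + c) '' ξ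

/-- `Θ = {θ_{x,t} : x ∈ ℝⁿ, t ∈ ℝ}` is a continuous ellipsoid cover of `ℝⁿ`: `θ_{x,t}` is an
ellipsoid `M_{x,t}(𝔹ⁿ) + x` with nonsingular matrix `M_{x,t}` and volume comparable to `2^{-t}`, and
intersecting ellipsoids satisfy the shape condition. -/
def IsContinuousCover {n : ℕ} (Θ : E n → ℝ → Set (E n)) : Prop :=
  ∃ a₁ a₂ a₃ a₄ a₅ a₆ : ℝ, 0 < a₁ ∧ 0 < a₂ ∧ 0 < a₃ ∧ 0 < a₄ ∧ 0 < a₅ ∧ 0 < a₆ ∧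
  ∃ M : E n → ℝ → Matrix (Fin n) (Fin n) ℝ,
    (∀ x t, (M x t).det ≠ 0 ∧ Θ x t = ellipsoid (M x t) x ∧
      a₁ * (2 : ℝ) ^ (-t) ≤ volume.real (Θ x t) ∧
      volume.real (Θ x t) ≤ a₂ * (2 : ℝ) ^ (-t)) ∧
    (∀ x y t s, 0 ≤ s → (Θ x t ∩ Θ y (t + s)).Nonempty →
      a₃ * (2 : ℝ) ^ (-(a₄ * s)) ≤ 1 / matNorm ((M y (t + s))⁻¹ * M x t) ∧
      1 / matNorm ((M y (t + s))⁻¹ * M x t) ≤ matNorm ((M x t)⁻¹ * M y (t + s)) ∧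
      matNorm ((M x t)⁻¹ * M y (t + s)) ≤ a₅ * (2 : ℝ) ^ (-(a₆ * s)))

/-- The function `ρ_Θ(x,y) = inf {|θ| : θ ∈ Θ, x ∈ θ, y ∈ θ}` induced by
`Θ = {θ_{z,t} : z ∈ ℝⁿ, t ∈ ℝ}`. -/
def inducedDist {n : ℕ} (Θ : E n → ℝ → Set (E n)) (x y : E n) : ℝ :=
  sInf {v : ℝ | ∃ z t, x ∈ Θ z t ∧ y ∈ Θ z t ∧ v = volume.real (Θ z t)}

/-- A quasi-distance on `ℝⁿ`. -/
structure IsQuasiDist {n : ℕ} (ρ : E n → E n → ℝ) : Prop where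
  nonneg : ∀ x y, 0 ≤ ρ x y
  eq_zero_iff : ∀ x y, ρ x y = 0 ↔ x = y
  symm : ∀ x y, ρ x y = ρ y x
  triangle : ∃ κ : ℝ, 1 ≤ κ ∧ ∀ x y z, ρ x z ≤ κ * (ρ x y + ρ y z)

/-- The ball `B_ρ(x,r) = {y : ρ(x,y) < r}`. -/
def qball {n : ℕ} (ρ : E n → E n → ℝ) (x : E n) (r : ℝ) : Set (E n) :=
  {y | ρ x y < r}

/-- `K` is `Q`-quasi-convex with respect to `x`, as witnessed by the ellipsoid `ξ`. -/
def IsQuasiConvexWitness {n : ℕ} (Q : ℝ) (x : E n) (K ξ : Set (E n)) : Prop :=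
  IsEllipsoidAt x ξ ∧ ξ ⊆ K ∧ K ⊆ dilate x Q ξ

/-- `ρ` is quasi-convex. -/
def IsQuasiConvex {n : ℕ} (ρ : E n → E n → ℝ) : Prop :=
  ∃ Q : ℝ, 1 ≤ Q ∧ ∀ (x : E n) (r : ℝ), 0 < r →
    ∃ ξ : Set (E n), IsQuasiConvexWitness Q x (qball ρ x r) ξ

/-- The family `{ξ_x^r : x ∈ ℝⁿ, r > 0}` is a family of ellipsoids corresponding to the
quasi-convex quasi-distance `ρ`, that is, `ξ_x^r ⊆ B_ρ(x,r) ⊆ Q · ξ_x^r` with one `Q` for all `x`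
and `r`. The values of `ξ` at `r ≤ 0` are irrelevant. -/
def IsCorrespondingFamily {n : ℕ} (ρ : E n → E n → ℝ) (ξ : E n → ℝ → Set (E n)) : Prop :=
  ∃ Q : ℝ, 1 ≤ Q ∧ ∀ (x : E n) (r : ℝ), 0 < r →
    IsQuasiConvexWitness Q x (qball ρ x r) (ξ x r)

/-- A family `{ξ_x^r : x ∈ ℝⁿ, r > 0}` as a family `{θ_{x,t} : x ∈ ℝⁿ, t ∈ ℝ}`, by means of the
change of parameter `r = 2^{-t}`. -/
def byScale {n : ℕ} (ξ : E n → ℝ → Set (E n)) : E n → ℝ → Set (E n) :=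
  fun x t => ξ x ((2 : ℝ) ^ (-t))

/-- `|B_ρ(x,r)| ∼ r` uniformly in `x ∈ ℝⁿ` and `r > 0`. (For a set that is not measurable,
`volume` is the outer Lebesgue measure.) -/
def IsAhlforsRegular {n : ℕ} (ρ : E n → E n → ℝ) : Prop :=
  ∃ c : ℝ, 1 ≤ c ∧ ∀ (x : E n) (r : ℝ), 0 < r →
    ENNReal.ofReal (r / c) ≤ volume (qball ρ x r) ∧
    volume (qball ρ x r) ≤ ENNReal.ofReal (c * r)

/-- Equivalence `ρ ∼ ρ'` of quasi-distances. -/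
def DistEquiv {n : ℕ} (ρ ρ' : E n → E n → ℝ) : Prop :=
  ∃ C : ℝ, 1 ≤ C ∧ ∀ x y, ρ x y ≤ C * ρ' x y ∧ ρ' x y ≤ C * ρ x y

/-- Equivalence of ellipsoid covers: `θ_{x,t} ⊆ C · θ'_{x,t}` and `θ'_{x,t} ⊆ C · θ_{x,t}`, with one
`C` for all `x` and `t`. -/
def CoverEquiv {n : ℕ} (Θ Θ' : E n → ℝ → Set (E n)) : Prop :=
  ∃ C : ℝ, 1 ≤ C ∧ ∀ x t, Θ x t ⊆ dilate x C (Θ' x t) ∧ Θ' x t ⊆ dilate x C (Θ x t)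

theorem DistEquiv.refl {n : ℕ} (ρ : E n → E n → ℝ) : DistEquiv ρ ρ :=
  ⟨1, le_rfl, fun x y => by simp⟩

theorem DistEquiv.symm {n : ℕ} {ρ ρ' : E n → E n → ℝ} (h : DistEquiv ρ ρ') : DistEquiv ρ' ρ := by
  obtain ⟨C, hC, h⟩ := h
  exact ⟨C, hC, fun x y => (h x y).symm⟩

theorem DistEquiv.trans {n : ℕ} {ρ ρ' ρ'' : E n → E n → ℝ} (h : DistEquiv ρ ρ')
    (h' : DistEquiv ρ' ρ'') : DistEquiv ρ ρ'' := by
  obtain ⟨C, hC, h⟩ := h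
  obtain ⟨D, hD, h'⟩ := h'
  have hC0 : 0 ≤ C := by linarith
  have hD0 : 0 ≤ D := by linarith
  refine ⟨C * D, one_le_mul_of_one_le_of_one_le hC hD, fun x y => ⟨?_, ?_⟩⟩
  · have := mul_le_mul_of_nonneg_left (h' x y).1 hC0
    linarith [(h x y).1]
  · have := mul_le_mul_of_nonneg_left (h x y).2 hD0
    linarith [(h' x y).2]

theorem dilate_one {n : ℕ} (c : E n) (ξ : Set (E n)) : dilate c 1 ξ = ξ := by
  simp [dilate]

theorem dilate_dilate {n : ℕ} (c : E n) (a b : ℝ) (ξ : Set (E n)) :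
    dilate c a (dilate c b ξ) = dilate c (a * b) ξ := by
  simp [dilate, Set.image_image, mul_smul]

theorem dilate_mono {n : ℕ} (c : E n) (a : ℝ) {ξ η : Set (E n)} (h : ξ ⊆ η) :
    dilate c a ξ ⊆ dilate c a η :=
  Set.image_mono h

theorem CoverEquiv.refl {n : ℕ} (Θ : E n → ℝ → Set (E n)) : CoverEquiv Θ Θ :=
  ⟨1, le_rfl, fun x t => by simp [dilate_one]⟩

theorem CoverEquiv.symm {n : ℕ} {Θ Θ' : E n → ℝ → Set (E n)} (h : CoverEquiv Θ Θ') :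
    CoverEquiv Θ' Θ := by
  obtain ⟨C, hC, h⟩ := h
  exact ⟨C, hC, fun x t => (h x t).symm⟩

theorem CoverEquiv.trans {n : ℕ} {Θ Θ' Θ'' : E n → ℝ → Set (E n)} (h : CoverEquiv Θ Θ')
    (h' : CoverEquiv Θ' Θ'') : CoverEquiv Θ Θ'' := by
  obtain ⟨C, hC, h⟩ := h
  obtain ⟨D, hD, h'⟩ := h'
  refine ⟨C * D, one_le_mul_of_one_le_of_one_le hC hD, fun x t => ⟨?_, ?_⟩⟩
  · have := (h x t).1.trans (dilate_mono x C (h' x t).1)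
    rwa [dilate_dilate] at this
  · have := (h' x t).2.trans (dilate_mono x D (h x t).2)
    rwa [dilate_dilate, mul_comm] at this

/-- The continuous ellipsoid covers of `ℝⁿ`. -/
def Cover (n : ℕ) : Type :=
  {Θ : E n → ℝ → Set (E n) // IsContinuousCover Θ}

/-- The quasi-convex, 1-Ahlfors-regular quasi-distances on `ℝⁿ`. -/
def RegularDist (n : ℕ) : Type :=
  {ρ : E n → E n → ℝ // IsQuasiDist ρ ∧ IsQuasiConvex ρ ∧ IsAhlforsRegular ρ}

instance coverSetoid (n : ℕ) : Setoid (Cover n) where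
  r Θ Θ' := CoverEquiv Θ.1 Θ'.1
  iseqv := ⟨fun Θ => CoverEquiv.refl Θ.1, CoverEquiv.symm, CoverEquiv.trans⟩

instance distSetoid (n : ℕ) : Setoid (RegularDist n) where
  r ρ ρ' := DistEquiv ρ.1 ρ'.1
  iseqv := ⟨fun ρ => DistEquiv.refl ρ.1, DistEquiv.symm, DistEquiv.trans⟩

end

end EllipsoidCover

open EllipsoidCover

open MeasureTheory

namespace EllipsoidCover

variable {n : ℕ}

/-! From covers to distances: when two ellipsoids of a cover meet, the shape condition puts the
finer one inside the coarser one after a bounded shift of scale (`exists_absorb`). This gives the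
quasi-triangle inequality and traps each ball of radius `2 ^ (-t)` between `Θ x (t + J)` and `Θ x (t
- L)`, whence quasi-convexity and regularity. Balls are uncountable unions of ellipsoids; a Lebesgue
density argument makes them measurable.

From distances to covers, volumes are immediate and the shape condition is the difficulty. Bounds on
`A⁻¹` and `|det A|` bound `A` (`exists_matNorm_le_mul_abs_det`), so inclusions of balls and
regularity compare nearby ellipsoids uniformly (`DistBounds.exists_matNorm_le`). Decay in scale
comes from a walk whose steps are a fixed portion of the small ellipsoid and cost a fixed factor in
the radius: a fixed enlargement of the radius therefore doubles the ellipsoid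
(`exists_matNorm_le_half`), and iteration gives a power of `s / r`.

Both maps respect equivalence because, in a cover, a bounded factor in the radius, a bounded shift
of scale and a bounded dilation can be traded for one another. -/

/-- The operator of a matrix on Euclidean space. -/
noncomputable abbrev opOf {n : ℕ} (M : Matrix (Fin n) (Fin n) ℝ) : E n →L[ℝ] E n :=
  Matrix.toEuclideanCLM (n := Fin n) (𝕜 := ℝ) M

/-! ### Ellipsoids and matrix norms. -/

theorem opOf_mul_apply (A B : Matrix (Fin n) (Fin n) ℝ) (v : E n) :
    opOf (A * B) v = opOf A (opOf B v) := by
  simp [opOf]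

theorem opOf_inv_apply_apply {M : Matrix (Fin n) (Fin n) ℝ} (h : M.det ≠ 0) (v : E n) :
    opOf M⁻¹ (opOf M v) = v := by
  rw [← opOf_mul_apply, Matrix.nonsing_inv_mul _ h.isUnit]; simp [opOf]

theorem opOf_apply_inv_apply {M : Matrix (Fin n) (Fin n) ℝ} (h : M.det ≠ 0) (v : E n) :
    opOf M (opOf M⁻¹ v) = v := by
  rw [← opOf_mul_apply, Matrix.mul_nonsing_inv _ h.isUnit]; simp [opOf]

theorem matNorm_nonneg (A : Matrix (Fin n) (Fin n) ℝ) : 0 ≤ matNorm A := norm_nonneg _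

theorem matNorm_mul_le (A B : Matrix (Fin n) (Fin n) ℝ) :
    matNorm (A * B) ≤ matNorm A * matNorm B := by
  unfold matNorm
  rw [map_mul]
  exact norm_mul_le _ _

theorem matNorm_smul (c : ℝ) (A : Matrix (Fin n) (Fin n) ℝ) :
    matNorm (c • A) = |c| * matNorm A := by
  unfold matNorm
  rw [map_smul, norm_smul, Real.norm_eq_abs]

theorem mem_ellipsoid {M : Matrix (Fin n) (Fin n) ℝ} (h : M.det ≠ 0) (c z : E n) :
    z ∈ ellipsoid M c ↔ ‖opOf M⁻¹ (z - c)‖ ≤ 1 := by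
  constructor
  · rintro ⟨y, hy, rfl⟩
    simpa [opOf_inv_apply_apply h] using hy
  · intro hz
    exact ⟨opOf M⁻¹ (z - c), by simpa using hz, by simp [opOf_apply_inv_apply h]⟩

theorem center_mem_ellipsoid (M : Matrix (Fin n) (Fin n) ℝ) (c : E n) : c ∈ ellipsoid M c :=
  ⟨0, by simp, by simp⟩

theorem mem_dilate {c z : E n} {lam : ℝ} (hl : 0 < lam) {ξ : Set (E n)} :
    z ∈ dilate c lam ξ ↔ lam⁻¹ • (z - c) + c ∈ ξ := by
  constructor
  · rintro ⟨y, hy, rfl⟩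
    simpa [smul_smul, hl.ne'] using hy
  · intro h
    exact ⟨_, h, by simp [smul_smul, hl.ne']⟩

theorem mem_dilate_ellipsoid {M : Matrix (Fin n) (Fin n) ℝ} (h : M.det ≠ 0) {c z : E n} {lam : ℝ}
    (hl : 0 < lam) : z ∈ dilate c lam (ellipsoid M c) ↔ ‖opOf M⁻¹ (z - c)‖ ≤ lam := by
  rw [mem_dilate hl, mem_ellipsoid h, add_sub_cancel_right, map_smul, norm_smul, Real.norm_eq_abs,
    abs_of_pos (inv_pos.2 hl), inv_mul_le_iff₀ hl, mul_one]

theorem norm_opOf_inv_le (A : Matrix (Fin n) (Fin n) ℝ) {B : Matrix (Fin n) (Fin n) ℝ}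
    (hB : B.det ≠ 0) (v : E n) : ‖opOf A⁻¹ v‖ ≤ matNorm (A⁻¹ * B) * ‖opOf B⁻¹ v‖ := by
  have : opOf A⁻¹ v = opOf (A⁻¹ * B) (opOf B⁻¹ v) := by
    rw [opOf_mul_apply, opOf_apply_inv_apply hB]
  rw [this]
  exact ContinuousLinearMap.le_opNorm _ _

theorem matNorm_le_of_forall {A B : Matrix (Fin n) (Fin n) ℝ} {C : ℝ} (hC : 0 ≤ C)
    (hB : B.det ≠ 0) (h : ∀ v, ‖opOf B⁻¹ v‖ ≤ 1 → ‖opOf A⁻¹ v‖ ≤ C) : matNorm (A⁻¹ * B) ≤ C := by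
  refine ContinuousLinearMap.opNorm_le_of_unit_norm hC fun w hw => ?_
  change ‖opOf (A⁻¹ * B) w‖ ≤ C
  rw [opOf_mul_apply]
  refine h _ ?_
  rw [opOf_inv_apply_apply hB, hw]

/-- The centers may differ: `2v` is the difference of the symmetric points `y + v` and `y - v`, so
the offset cancels and no constant is lost. -/
theorem matNorm_le_of_ellipsoid_subset {A B : Matrix (Fin n) (Fin n) ℝ} {C : ℝ} (hC : 0 < C)
    (hA : A.det ≠ 0) (hB : B.det ≠ 0) {x y : E n}
    (h : ellipsoid B y ⊆ dilate x C (ellipsoid A x)) : matNorm (A⁻¹ * B) ≤ C := by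
  refine matNorm_le_of_forall hC.le hB fun v hv => ?_
  have h1 := (mem_dilate_ellipsoid hA hC).1 (h ((mem_ellipsoid hB y (y + v)).2 (by simpa using hv)))
  have h2 := (mem_dilate_ellipsoid hA hC).1 (h ((mem_ellipsoid hB y (y - v)).2 (by simpa using hv)))
  have h3 : (2 : ℝ) • opOf A⁻¹ v = opOf A⁻¹ (y + v - x) - opOf A⁻¹ (y - v - x) := by
    rw [← map_sub, ← map_smul]; congr 1; module
  have h4 : 2 * ‖opOf A⁻¹ v‖ ≤ C + C := by
    have := norm_smul (2 : ℝ) (opOf A⁻¹ v)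
    rw [Real.norm_ofNat] at this
    rw [← this, h3]
    exact (norm_sub_le _ _).trans (add_le_add h1 h2)
  linarith

theorem dilate_ellipsoid (M : Matrix (Fin n) (Fin n) ℝ) (c : E n) (lam : ℝ) :
    dilate c lam (ellipsoid M c) = ellipsoid (lam • M) c := by
  simp [dilate, ellipsoid, Set.image_image]

theorem volume_ellipsoid (M : Matrix (Fin n) (Fin n) ℝ) (c : E n) :
    volume (ellipsoid M c) =
      ENNReal.ofReal |M.det| * volume (Metric.closedBall (0 : E n) 1) := by
  have h : ellipsoid M c = (fun y => y + c) '' (opOf M '' Metric.closedBall 0 1) := by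
    simp [ellipsoid, Set.image_image]
  rw [h, Set.image_add_right, measure_preimage_add_right,
    Measure.addHaar_image_continuousLinearMap]
  congr 3
  exact LinearMap.det_toLpLin 2 M

theorem volume_closedBall_real_pos (n : ℕ) : 0 < volume.real (Metric.closedBall (0 : E n) 1) :=
  ENNReal.toReal_pos (Metric.measure_closedBall_pos _ _ one_pos).ne'
    measure_closedBall_lt_top.ne

theorem volume_real_ellipsoid (M : Matrix (Fin n) (Fin n) ℝ) (c : E n) :
    volume.real (ellipsoid M c) = |M.det| * volume.real (Metric.closedBall (0 : E n) 1) := by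
  simp [measureReal_def, volume_ellipsoid]

theorem volume_ellipsoid_ne_top (M : Matrix (Fin n) (Fin n) ℝ) (c : E n) :
    volume (ellipsoid M c) ≠ ⊤ := by
  rw [volume_ellipsoid]
  exact ENNReal.mul_ne_top ENNReal.ofReal_ne_top measure_closedBall_lt_top.ne

theorem volume_real_dilate_ellipsoid (M : Matrix (Fin n) (Fin n) ℝ) (c : E n) {lam : ℝ}
    (hl : 0 ≤ lam) :
    volume.real (dilate c lam (ellipsoid M c)) = lam ^ n * volume.real (ellipsoid M c) := by
  rw [dilate_ellipsoid, volume_real_ellipsoid, volume_real_ellipsoid, Matrix.det_smul, abs_mul,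
    abs_of_nonneg (pow_nonneg hl _), Fintype.card_fin, mul_assoc]

theorem convex_ellipsoid (M : Matrix (Fin n) (Fin n) ℝ) (c : E n) : Convex ℝ (ellipsoid M c) := by
  have h : ellipsoid M c = (fun y => y + c) '' (opOf M '' Metric.closedBall 0 1) := by
    simp [ellipsoid, Set.image_image]
  rw [h]
  simp only [add_comm _ c]
  exact ((convex_closedBall (0 : E n) 1).linear_image (opOf M).toLinearMap).translate c

/-- `A = det A • adj(A⁻¹)`, and the adjugate is continuous, hence bounded on the compact set of
matrices with entries in `[-K, K]`. -/
theorem exists_matNorm_le_mul_abs_det (n : ℕ) (K : ℝ) : ∃ C : ℝ, 0 < C ∧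
    ∀ A : Matrix (Fin n) (Fin n) ℝ, A.det ≠ 0 → matNorm A⁻¹ ≤ K → matNorm A ≤ C * |A.det| := by
  have hcomp : IsCompact {B : Matrix (Fin n) (Fin n) ℝ | ∀ i j, B i j ∈ Set.Icc (-K) K} := by
    have : {B : Matrix (Fin n) (Fin n) ℝ | ∀ i j, B i j ∈ Set.Icc (-K) K} =
        Set.pi Set.univ fun _ => Set.pi Set.univ fun _ => Set.Icc (-K) K := by
      ext B
      exact ⟨fun h i _ j _ => h i j, fun h i j => h i trivial j trivial⟩
    rw [this]
    exact isCompact_univ_pi fun _ => isCompact_univ_pi fun _ => isCompact_Icc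
  have hop : Continuous fun B : Matrix (Fin n) (Fin n) ℝ => opOf B :=
    LinearMap.continuous_of_finiteDimensional
      (Matrix.toEuclideanCLM (n := Fin n) (𝕜 := ℝ)).toAlgEquiv.toLinearMap
  have hcont : Continuous fun B : Matrix (Fin n) (Fin n) ℝ => opOf B.adjugate :=
    hop.comp (Continuous.matrix_adjugate continuous_id)
  obtain ⟨C, hC⟩ := hcomp.exists_bound_of_continuousOn hcont.continuousOn
  refine ⟨max C 1, by positivity, fun A hA hK => ?_⟩
  have hentry : ∀ i j, A⁻¹ i j ∈ Set.Icc (-K) K := by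
    intro i j
    rw [Set.mem_Icc, ← abs_le]
    have h1 : A⁻¹ i j = (opOf A⁻¹ (EuclideanSpace.single j 1)) i := by
      simp [opOf]
    rw [h1, ← Real.norm_eq_abs]
    refine (PiLp.norm_apply_le _ i).trans ((ContinuousLinearMap.le_opNorm _ _).trans ?_)
    rw [PiLp.norm_single, norm_one, mul_one]
    exact hK
  have h2 : A = A.det • (A⁻¹).adjugate := by
    have hu : IsUnit A.det := hA.isUnit
    have h3 : A⁻¹⁻¹ = A := Matrix.nonsing_inv_nonsing_inv A hu
    conv_lhs => rw [← h3, Matrix.inv_def, Matrix.det_nonsing_inv]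
    simp
  have h4 : matNorm (A⁻¹).adjugate ≤ max C 1 := (hC _ hentry).trans (le_max_left _ _)
  calc matNorm A = |A.det| * matNorm (A⁻¹).adjugate := by
        conv_lhs => rw [h2, matNorm_smul]
    _ ≤ |A.det| * max C 1 := by gcongr
    _ = _ := mul_comm _ _

/-- The two products are mutually inverse, and the identity has norm 1 only in positive dimension.
-/
theorem one_le_matNorm_mul_matNorm (hn : n ≠ 0) {A B : Matrix (Fin n) (Fin n) ℝ}
    (hA : A.det ≠ 0) (hB : B.det ≠ 0) : 1 ≤ matNorm (A⁻¹ * B) * matNorm (B⁻¹ * A) := by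
  have : Nonempty (Fin n) := ⟨⟨0, Nat.pos_of_ne_zero hn⟩⟩
  have h : (A⁻¹ * B) * (B⁻¹ * A) = 1 := by
    rw [Matrix.mul_assoc, ← Matrix.mul_assoc B, Matrix.mul_nonsing_inv _ hB.isUnit, Matrix.one_mul,
      Matrix.nonsing_inv_mul _ hA.isUnit]
  have h1 : matNorm (1 : Matrix (Fin n) (Fin n) ℝ) = 1 := by
    simp [matNorm]
  rw [← h1, ← h]
  exact matNorm_mul_le _ _

/-- A union of convex sets of positive volume is Lebesgue measurable. -/
theorem nullMeasurableSet_sUnion_of_convex {S : Set (Set (E n))} (hconv : ∀ s ∈ S, Convex ℝ s)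
    (hpos : ∀ s ∈ S, volume s ≠ 0) : NullMeasurableSet (⋃₀ S) volume := by
  set V : Set (E n) := ⋃ s ∈ S, interior s with hV
  have hVo : IsOpen V := isOpen_biUnion fun s _ => isOpen_interior
  have hVU : V ⊆ ⋃₀ S := Set.iUnion₂_subset fun s hs =>
    interior_subset.trans (Set.subset_sUnion_of_mem hs)
  have hint : ∀ s ∈ S, volume (interior s) ≠ 0 := fun s hs h0 =>
    hpos s hs (by
      refine measure_mono_null subset_closure ?_
      rw [closure_eq_interior_union_frontier]
      exact measure_union_null h0 ((hconv s hs).addHaar_frontier volume))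
  have hdens := Besicovitch.ae_tendsto_measure_inter_div (volume : Measure (E n)) Vᶜ
  rw [ae_restrict_iff' hVo.measurableSet.compl] at hdens
  have hnull : volume (⋃₀ S \ V) = 0 := by
    refine measure_mono_null ?_ hdens
    rintro y ⟨⟨s, hs, hys⟩, hyV⟩ hy
    have hy := hy hyV
    -- If `y` were a density point of the complement of `V`, small homothetic copies of `interior s`
    -- at `y` would meet that complement; by convexity they lie in `interior s ⊆ V`.
    obtain ⟨r, hr, hr0, hr1⟩ := ((Measure.eventually_nonempty_inter_smul_of_density_one volume Vᶜ y
      hy ((fun z => z - y) '' interior s) (by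
        simp only [sub_eq_add_neg, Set.image_add_right]
        exact (measurable_id.add_const _) isOpen_interior.measurableSet) (by
        simp only [sub_eq_add_neg, Set.image_add_right]
        rw [measure_preimage_add_right]
        exact hint s hs)).and (Ioc_mem_nhdsGT (zero_lt_one (α := ℝ)))).exists
    obtain ⟨z, hzV, hz⟩ := hr
    refine hzV (Set.mem_biUnion hs ?_)
    simp only [Set.singleton_add, Set.mem_image, Set.mem_smul_set] at hz
    obtain ⟨_, ⟨_, ⟨w, hw, rfl⟩, rfl⟩, rfl⟩ := hz
    exact (hconv s hs).add_smul_sub_mem_interior hys hw ⟨hr0, hr1⟩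
  rw [← Set.union_sdiff_cancel hVU]
  exact hVo.measurableSet.nullMeasurableSet.union (NullMeasurableSet.of_null hnull)

/-! ### From a cover to its quasi-distance. -/

/-- Matrices and constants witnessing that `Θ` is a continuous ellipsoid cover. -/
structure CoverBounds (Θ : E n → ℝ → Set (E n)) (M : E n → ℝ → Matrix (Fin n) (Fin n) ℝ)
    (a₁ a₂ a₃ a₄ a₅ a₆ : ℝ) : Prop where
  pos₁ : 0 < a₁
  pos₂ : 0 < a₂
  pos₃ : 0 < a₃
  pos₅ : 0 < a₅
  pos₆ : 0 < a₆
  det_ne : ∀ x t, (M x t).det ≠ 0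
  eq : ∀ x t, Θ x t = ellipsoid (M x t) x
  le_volume : ∀ x t, a₁ * (2 : ℝ) ^ (-t) ≤ volume.real (Θ x t)
  volume_le : ∀ x t, volume.real (Θ x t) ≤ a₂ * (2 : ℝ) ^ (-t)
  coarse_le : ∀ x y t s, 0 ≤ s → (Θ x t ∩ Θ y (t + s)).Nonempty →
    matNorm ((M y (t + s))⁻¹ * M x t) ≤ a₃⁻¹ * (2 : ℝ) ^ (a₄ * s)
  fine_le : ∀ x y t s, 0 ≤ s → (Θ x t ∩ Θ y (t + s)).Nonempty →
    matNorm ((M x t)⁻¹ * M y (t + s)) ≤ a₅ * (2 : ℝ) ^ (-(a₆ * s))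

theorem IsContinuousCover.exists_bounds {Θ : E n → ℝ → Set (E n)} (h : IsContinuousCover Θ) :
    ∃ M a₁ a₂ a₃ a₄ a₅ a₆, CoverBounds Θ M a₁ a₂ a₃ a₄ a₅ a₆ := by
  obtain ⟨a₁, a₂, a₃, a₄, a₅, a₆, h₁, h₂, h₃, h₄, h₅, h₆, M, hM, hs⟩ := h
  refine ⟨M, a₁, a₂, a₃, a₄, a₅, a₆, h₁, h₂, h₃, h₅, h₆, fun x t => (hM x t).1,
    fun x t => (hM x t).2.1, fun x t => (hM x t).2.2.1, fun x t => (hM x t).2.2.2,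
    fun x y t s hs0 hne => ?_, fun x y t s hs0 hne => (hs x y t s hs0 hne).2.2⟩
  have h := (hs x y t s hs0 hne).1
  have hp : 0 < a₃ * (2 : ℝ) ^ (-(a₄ * s)) := by positivity
  -- Since `1 / 0 = 0`, the positive lower bound excludes norm zero. In particular there are no
  -- covers in dimension 0.
  have hN : 0 < matNorm ((M y (t + s))⁻¹ * M x t) := one_div_pos.1 (hp.trans_le h)
  rw [le_one_div hp hN] at h
  refine h.trans_eq ?_
  rw [Real.rpow_neg two_pos.le, one_div, mul_inv, inv_inv]

theorem exists_mul_rpow_le (a : ℝ) {b ε : ℝ} (hb : 0 < b) (hε : 0 < ε) :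
    ∃ J : ℝ, 0 ≤ J ∧ a * (2 : ℝ) ^ (-(b * J)) ≤ ε := by
  have h0 : Filter.Tendsto (fun J : ℝ => a * (2 : ℝ) ^ (-(b * J))) Filter.atTop (nhds (a * 0)) := by
    refine Filter.Tendsto.const_mul a ?_
    refine (tendsto_rpow_atBot_of_base_gt_one 2 one_lt_two).comp ?_
    exact Filter.tendsto_neg_atTop_atBot.comp (Filter.tendsto_id.const_mul_atTop hb)
  rw [mul_zero] at h0
  obtain ⟨J, h1, h2⟩ := ((Filter.eventually_ge_atTop (0 : ℝ)).and
    (h0.eventually (gt_mem_nhds hε))).exists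
  exact ⟨J, h1, h2.le⟩

theorem inducedDist_set_bddBelow (Θ : E n → ℝ → Set (E n)) (x y : E n) :
    BddBelow {v : ℝ | ∃ z t, x ∈ Θ z t ∧ y ∈ Θ z t ∧ v = volume.real (Θ z t)} :=
  ⟨0, by rintro _ ⟨z, t, -, -, rfl⟩; exact measureReal_nonneg⟩

theorem inducedDist_le (Θ : E n → ℝ → Set (E n)) {x y z : E n} {t : ℝ} (hx : x ∈ Θ z t)
    (hy : y ∈ Θ z t) : inducedDist Θ x y ≤ volume.real (Θ z t) :=
  csInf_le (inducedDist_set_bddBelow Θ x y) ⟨z, t, hx, hy, rfl⟩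

theorem inducedDist_nonneg (Θ : E n → ℝ → Set (E n)) (x y : E n) : 0 ≤ inducedDist Θ x y :=
  Real.sInf_nonneg (by rintro _ ⟨z, t, -, -, rfl⟩; exact measureReal_nonneg)

theorem inducedDist_comm (Θ : E n → ℝ → Set (E n)) (x y : E n) :
    inducedDist Θ x y = inducedDist Θ y x := by
  unfold inducedDist
  congr 1
  ext v
  exact ⟨fun ⟨z, t, a, b, c⟩ => ⟨z, t, b, a, c⟩, fun ⟨z, t, a, b, c⟩ => ⟨z, t, b, a, c⟩⟩

theorem exists_two_rpow_neg {r : ℝ} (hr : 0 < r) : ∃ t : ℝ, (2 : ℝ) ^ (-t) = r :=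
  ⟨-Real.logb 2 r, by rw [neg_neg, Real.rpow_logb two_pos (by norm_num) hr]⟩

namespace CoverBounds

variable {Θ : E n → ℝ → Set (E n)} {M : E n → ℝ → Matrix (Fin n) (Fin n) ℝ}
  {a₁ a₂ a₃ a₄ a₅ a₆ : ℝ}

theorem mem_iff (h : CoverBounds Θ M a₁ a₂ a₃ a₄ a₅ a₆) {x z : E n} {t : ℝ} :
    z ∈ Θ x t ↔ ‖opOf (M x t)⁻¹ (z - x)‖ ≤ 1 := by
  rw [h.eq, mem_ellipsoid (h.det_ne x t)]

theorem mem_dilate_iff (h : CoverBounds Θ M a₁ a₂ a₃ a₄ a₅ a₆) {x z : E n} {t C : ℝ} (hC : 0 < C) :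
    z ∈ dilate x C (Θ x t) ↔ ‖opOf (M x t)⁻¹ (z - x)‖ ≤ C := by
  rw [h.eq, mem_dilate_ellipsoid (h.det_ne x t) hC]

theorem center_mem (h : CoverBounds Θ M a₁ a₂ a₃ a₄ a₅ a₆) (x : E n) (t : ℝ) : x ∈ Θ x t := by
  rw [h.eq]; exact center_mem_ellipsoid _ _

theorem volume_pos (h : CoverBounds Θ M a₁ a₂ a₃ a₄ a₅ a₆) (x : E n) (t : ℝ) :
    0 < volume.real (Θ x t) :=
  (mul_pos h.pos₁ (by positivity)).trans_le (h.le_volume x t)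

theorem volume_ne_top (h : CoverBounds Θ M a₁ a₂ a₃ a₄ a₅ a₆) (x : E n) (t : ℝ) :
    volume (Θ x t) ≠ ⊤ := by
  rw [h.eq]; exact volume_ellipsoid_ne_top _ _

/-- Dilates of ellipsoids of a cover are contained in ellipsoids of a coarser scale. -/
theorem exists_dilate_subset (h : CoverBounds Θ M a₁ a₂ a₃ a₄ a₅ a₆) {C : ℝ} (hC : 0 < C) :
    ∃ J : ℝ, 0 ≤ J ∧ ∀ x t, dilate x C (Θ x t) ⊆ Θ x (t - J) := by
  obtain ⟨J, hJ, hle⟩ := exists_mul_rpow_le a₅ h.pos₆ (inv_pos.2 hC)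
  refine ⟨J, hJ, fun x t z hz => ?_⟩
  have hf := h.fine_le x x (t - J) J hJ ⟨x, h.center_mem _ _, h.center_mem _ _⟩
  rw [sub_add_cancel] at hf
  rw [h.mem_dilate_iff hC] at hz
  rw [h.mem_iff]
  calc ‖opOf (M x (t - J))⁻¹ (z - x)‖ ≤ matNorm ((M x (t - J))⁻¹ * M x t) * ‖opOf (M x t)⁻¹ (z - x)‖ :=
        norm_opOf_inv_le _ (h.det_ne x t) _
    _ ≤ C⁻¹ * C := by
        gcongr
        exact hf.trans hle
    _ = 1 := inv_mul_cancel₀ hC.ne'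

/-- The ellipsoids of a coarser scale are contained in dilates of those of a finer scale. -/
theorem exists_subset_dilate (h : CoverBounds Θ M a₁ a₂ a₃ a₄ a₅ a₆) {J : ℝ} (hJ : 0 ≤ J) :
    ∃ C : ℝ, 1 ≤ C ∧ ∀ x t, Θ x (t - J) ⊆ dilate x C (Θ x t) := by
  refine ⟨max 1 (a₃⁻¹ * (2 : ℝ) ^ (a₄ * J)), le_max_left _ _, fun x t z hz => ?_⟩
  have hf := h.coarse_le x x (t - J) J hJ ⟨x, h.center_mem _ _, h.center_mem _ _⟩
  rw [sub_add_cancel] at hf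
  rw [h.mem_iff] at hz
  rw [h.mem_dilate_iff (by positivity)]
  calc ‖opOf (M x t)⁻¹ (z - x)‖
      ≤ matNorm ((M x t)⁻¹ * M x (t - J)) * ‖opOf (M x (t - J))⁻¹ (z - x)‖ :=
        norm_opOf_inv_le _ (h.det_ne x _) _
    _ ≤ max 1 (a₃⁻¹ * (2 : ℝ) ^ (a₄ * J)) * 1 := by
        gcongr
        exact hf.trans (le_max_right _ _)
    _ = _ := mul_one _

/-- An ellipsoid that meets another one of a finer scale contains it after coarsening. -/
theorem exists_absorb (h : CoverBounds Θ M a₁ a₂ a₃ a₄ a₅ a₆) :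
    ∃ J : ℝ, 0 ≤ J ∧ ∀ x y t u, t ≤ u → (Θ x t ∩ Θ y u).Nonempty → Θ y u ⊆ Θ x (t - J) := by
  have ha := h.pos₅
  have ha6 := h.pos₆
  -- With `w` a common point, `z - x = (w - x) + (z - y) - (w - y)`; in the norm of the coarse
  -- ellipsoid the terms are at most `1`, `a₅`, `a₅`.
  have hC : 0 < 1 + 2 * a₅ := by linarith
  obtain ⟨J, hJ, hsub⟩ := h.exists_dilate_subset hC
  refine ⟨J, hJ, fun x y t u htu hne z hz => hsub x t ?_⟩
  have hs : 0 ≤ u - t := sub_nonneg.2 htu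
  have hf := h.fine_le x y t (u - t) hs (by rwa [add_sub_cancel])
  rw [add_sub_cancel] at hf
  have hle : matNorm ((M x t)⁻¹ * M y u) ≤ a₅ := by
    refine hf.trans (mul_le_of_le_one_right ha.le ?_)
    exact Real.rpow_le_one_of_one_le_of_nonpos one_le_two (by nlinarith [mul_nonneg ha6.le hs])
  obtain ⟨w, hwx, hwy⟩ := hne
  rw [h.mem_iff] at hwx hwy hz
  rw [h.mem_dilate_iff hC]
  have hsplit : opOf (M x t)⁻¹ (z - x) =
      opOf (M x t)⁻¹ (w - x) + opOf (M x t)⁻¹ (z - y) - opOf (M x t)⁻¹ (w - y) := by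
    rw [← map_add, ← map_sub]; congr 1; abel
  have hb : ∀ v, ‖opOf (M y u)⁻¹ v‖ ≤ 1 → ‖opOf (M x t)⁻¹ v‖ ≤ a₅ := fun v hv =>
    (norm_opOf_inv_le _ (h.det_ne y u) v).trans
      ((mul_le_mul hle hv (norm_nonneg _) ha.le).trans_eq (mul_one _))
  rw [hsplit]
  have := norm_sub_le (opOf (M x t)⁻¹ (w - x) + opOf (M x t)⁻¹ (z - y)) (opOf (M x t)⁻¹ (w - y))
  have := norm_add_le (opOf (M x t)⁻¹ (w - x)) (opOf (M x t)⁻¹ (z - y))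
  linarith [hb _ hwy, hb _ hz]

theorem exists_mem (h : CoverBounds Θ M a₁ a₂ a₃ a₄ a₅ a₆) (x y : E n) : ∃ t, y ∈ Θ x t := by
  have hC : 0 < ‖opOf (M x 0)⁻¹ (y - x)‖ + 1 := by positivity
  obtain ⟨J, -, hJ⟩ := h.exists_dilate_subset hC
  exact ⟨0 - J, hJ x 0 ((h.mem_dilate_iff hC).2 (by linarith))⟩

theorem inducedDist_set_nonempty (h : CoverBounds Θ M a₁ a₂ a₃ a₄ a₅ a₆) (x y : E n) :
    {v : ℝ | ∃ z t, x ∈ Θ z t ∧ y ∈ Θ z t ∧ v = volume.real (Θ z t)}.Nonempty := by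
  obtain ⟨t, ht⟩ := h.exists_mem x y
  exact ⟨_, x, t, h.center_mem _ _, ht, rfl⟩

theorem inducedDist_lt_iff (h : CoverBounds Θ M a₁ a₂ a₃ a₄ a₅ a₆) {x y : E n} {r : ℝ} :
    inducedDist Θ x y < r ↔ ∃ z t, x ∈ Θ z t ∧ y ∈ Θ z t ∧ volume.real (Θ z t) < r := by
  unfold inducedDist
  rw [csInf_lt_iff (inducedDist_set_bddBelow Θ x y) (h.inducedDist_set_nonempty x y)]
  constructor
  · rintro ⟨_, ⟨z, t, hx, hy, rfl⟩, hr⟩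
    exact ⟨z, t, hx, hy, hr⟩
  · rintro ⟨z, t, hx, hy, hr⟩
    exact ⟨_, ⟨z, t, hx, hy, rfl⟩, hr⟩

theorem le_mul_inducedDist (h : CoverBounds Θ M a₁ a₂ a₃ a₄ a₅ a₆) {x y : E n} {d C : ℝ}
    (hC : 0 < C) (hd : ∀ z t, x ∈ Θ z t → y ∈ Θ z t → d ≤ C * volume.real (Θ z t)) :
    d ≤ C * inducedDist Θ x y := by
  rw [mul_comm, ← div_le_iff₀ hC]
  refine le_csInf (h.inducedDist_set_nonempty x y) ?_
  rintro _ ⟨z, t, hx, hy, rfl⟩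
  rw [div_le_iff₀ hC, mul_comm]
  exact hd z t hx hy

theorem volume_sub_le (h : CoverBounds Θ M a₁ a₂ a₃ a₄ a₅ a₆) {M' : E n → ℝ → Matrix (Fin n) (Fin n) ℝ}
    {Θ' : E n → ℝ → Set (E n)} {b₁ b₂ b₃ b₄ b₅ b₆ : ℝ} (h' : CoverBounds Θ' M' b₁ b₂ b₃ b₄ b₅ b₆)
    (x z : E n) (t J : ℝ) :
    volume.real (Θ' z (t - J)) ≤ b₂ * 2 ^ J / a₁ * volume.real (Θ x t) := by
  have h1 := h.pos₁
  have h2 := h'.pos₂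
  calc volume.real (Θ' z (t - J)) ≤ b₂ * 2 ^ (-(t - J)) := h'.volume_le z _
    _ = b₂ * 2 ^ J / a₁ * (a₁ * 2 ^ (-t)) := by
        rw [neg_sub, sub_eq_add_neg, Real.rpow_add two_pos]; field_simp
    _ ≤ _ := by
        gcongr
        exact h.le_volume x t

/-- Two ellipsoids through `y` both lie in the enlargement of the coarser one, whose volume grows
only by a bounded factor. -/
theorem exists_triangle (h : CoverBounds Θ M a₁ a₂ a₃ a₄ a₅ a₆) :
    ∃ κ : ℝ, 1 ≤ κ ∧ ∀ x y z,
      inducedDist Θ x z ≤ κ * (inducedDist Θ x y + inducedDist Θ y z) := by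
  obtain ⟨J, hJ, hsub⟩ := h.exists_absorb
  set κ := max 1 (a₂ * 2 ^ J / a₁) with hκ
  have hκ0 : 0 < κ := by positivity
  have key : ∀ x y z u v t s, x ∈ Θ u t → y ∈ Θ u t → y ∈ Θ v s → z ∈ Θ v s → t ≤ s →
      inducedDist Θ x z ≤ κ * volume.real (Θ u t) := by
    intro x y z u v t s hx hy hy' hz hts
    have h1 := hsub u v t s hts ⟨y, hy, hy'⟩ hz
    have h2 := hsub u u t t le_rfl ⟨y, hy, hy⟩ hx
    refine (inducedDist_le Θ h2 h1).trans ((h.volume_sub_le h u u t J).trans ?_)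
    gcongr
    exact le_max_right _ _
  refine ⟨κ, le_max_left _ _, fun x y z => ?_⟩
  refine le_of_forall_pos_lt_add fun ε hε => ?_
  have hε' : 0 < ε / (2 * κ) := by positivity
  obtain ⟨u, t, hx, hy, h1⟩ := h.inducedDist_lt_iff.1 (lt_add_of_pos_right (inducedDist Θ x y) hε')
  obtain ⟨v, s, hy', hz, h2⟩ := h.inducedDist_lt_iff.1 (lt_add_of_pos_right (inducedDist Θ y z) hε')
  have hsum : inducedDist Θ x z ≤ κ * (volume.real (Θ u t) + volume.real (Θ v s)) := by
    rcases le_total t s with hts | hts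
    · refine (key x y z u v t s hx hy hy' hz hts).trans ?_
      gcongr
      linarith [h.volume_pos v s]
    · rw [inducedDist_comm]
      refine (key z y x v u s t hz hy' hy hx hts).trans ?_
      gcongr
      linarith [h.volume_pos u t]
  refine hsum.trans_lt ?_
  have h3 : κ * (volume.real (Θ u t) + volume.real (Θ v s)) <
      κ * (inducedDist Θ x y + ε / (2 * κ) + (inducedDist Θ y z + ε / (2 * κ))) := by gcongr
  refine h3.trans_eq ?_
  field_simp
  ring

theorem inducedDist_self (h : CoverBounds Θ M a₁ a₂ a₃ a₄ a₅ a₆) (x : E n) :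
    inducedDist Θ x x = 0 := by
  refine le_antisymm (le_of_forall_pos_le_add fun ε hε => ?_) (inducedDist_nonneg Θ x x)
  obtain ⟨J, -, hJ⟩ := exists_mul_rpow_le a₂ one_pos hε
  rw [one_mul] at hJ
  rw [zero_add]
  exact (inducedDist_le Θ (h.center_mem x J) (h.center_mem x J)).trans ((h.volume_le x J).trans hJ)

/-- Points at small induced distance lie in an ellipsoid of a fine scale. -/
theorem exists_mem_of_inducedDist_lt (h : CoverBounds Θ M a₁ a₂ a₃ a₄ a₅ a₆) :
    ∃ J : ℝ, 0 ≤ J ∧ ∀ x y t, inducedDist Θ x y < 2 ^ (-t) → y ∈ Θ x (t - J) := by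
  obtain ⟨J, hJ, hsub⟩ := h.exists_absorb
  have h1 := h.pos₁
  -- With `2 ^ (-c) ≤ a₁`, an ellipsoid of volume below `2 ^ (-t)` has scale at least `t - c`.
  obtain ⟨c, hc, hle⟩ := exists_mul_rpow_le 1 one_pos h1
  rw [one_mul, one_mul] at hle
  refine ⟨c + J, by positivity, fun x y t hxy => ?_⟩
  obtain ⟨z, s, hx, hy, hlt⟩ := h.inducedDist_lt_iff.1 hxy
  have h2 : (2 : ℝ) ^ (-c + -s) < 2 ^ (-t) := by
    rw [Real.rpow_add two_pos]
    refine lt_of_le_of_lt ?_ (((h.le_volume z s)).trans_lt hlt)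
    gcongr
  have h3 : t - c ≤ s := by
    have := (Real.rpow_lt_rpow_left_iff one_lt_two).1 h2
    linarith
  rw [← sub_sub]
  exact hsub x z (t - c) s h3 ⟨x, h.center_mem _ _, hx⟩ hy

/-- At distance zero `y` lies in `Θ x s` for every `s`, and these shrink to `x` by the fine bound.
-/
theorem eq_of_inducedDist_eq_zero (h : CoverBounds Θ M a₁ a₂ a₃ a₄ a₅ a₆) {x y : E n}
    (hxy : inducedDist Θ x y = 0) : x = y := by
  obtain ⟨J, -, hsub⟩ := h.exists_mem_of_inducedDist_lt
  have hz : ‖opOf (M x 0)⁻¹ (y - x)‖ ≤ 0 := by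
    refine le_of_forall_pos_le_add fun ε hε => ?_
    obtain ⟨s, hs, hle⟩ := exists_mul_rpow_le a₅ h.pos₆ hε
    have hy : y ∈ Θ x (0 + s) := by
      have := hsub x y (s + J) (by rw [hxy]; positivity)
      simpa using this
    have hf := h.fine_le x x 0 s hs ⟨x, h.center_mem _ _, h.center_mem _ _⟩
    rw [h.mem_iff] at hy
    have h1 := norm_opOf_inv_le (M x 0) (h.det_ne x (0 + s)) (y - x)
    have h2 := mul_le_mul (hf.trans hle) hy (norm_nonneg _) hε.le
    linarith
  have h0 : opOf (M x 0)⁻¹ (y - x) = 0 := norm_le_zero_iff.1 hz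
  have h1 := opOf_apply_inv_apply (h.det_ne x 0) (y - x)
  rw [h0, map_zero] at h1
  exact (sub_eq_zero.1 h1.symm).symm

theorem isQuasiDist (h : CoverBounds Θ M a₁ a₂ a₃ a₄ a₅ a₆) : IsQuasiDist (inducedDist Θ) where
  nonneg := inducedDist_nonneg Θ
  eq_zero_iff x y := ⟨h.eq_of_inducedDist_eq_zero, by rintro rfl; exact h.inducedDist_self x⟩
  symm := inducedDist_comm Θ
  triangle := h.exists_triangle

/-- The inner half of the sandwich of balls; `exists_qball_subset` is the outer half. -/
theorem exists_subset_qball (h : CoverBounds Θ M a₁ a₂ a₃ a₄ a₅ a₆) :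
    ∃ J : ℝ, 0 ≤ J ∧ ∀ x t, Θ x (t + J) ⊆ qball (inducedDist Θ) x (2 ^ (-t)) := by
  obtain ⟨J, hJ, hle⟩ := exists_mul_rpow_le a₂ one_pos (one_half_pos (α := ℝ))
  rw [one_mul] at hle
  refine ⟨J, hJ, fun x t y hy => ?_⟩
  refine (inducedDist_le Θ (h.center_mem _ _) hy).trans_lt ((h.volume_le _ _).trans_lt ?_)
  have hp : (0 : ℝ) < 2 ^ (-t) := by positivity
  rw [neg_add, add_comm, Real.rpow_add two_pos, ← mul_assoc]
  have := mul_le_mul_of_nonneg_right hle hp.le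
  linarith

theorem exists_qball_subset (h : CoverBounds Θ M a₁ a₂ a₃ a₄ a₅ a₆) :
    ∃ J : ℝ, 0 ≤ J ∧ ∀ x t, qball (inducedDist Θ) x (2 ^ (-t)) ⊆ Θ x (t - J) := by
  obtain ⟨J, hJ, hsub⟩ := h.exists_mem_of_inducedDist_lt
  exact ⟨J, hJ, fun x t y hy => hsub x y t hy⟩

theorem isQuasiConvex (h : CoverBounds Θ M a₁ a₂ a₃ a₄ a₅ a₆) : IsQuasiConvex (inducedDist Θ) := by
  obtain ⟨J, hJ, hin⟩ := h.exists_subset_qball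
  obtain ⟨L, hL, hout⟩ := h.exists_qball_subset
  obtain ⟨Q, hQ, hsub⟩ := h.exists_subset_dilate (add_nonneg hJ hL)
  refine ⟨Q, hQ, fun x r hr => ?_⟩
  obtain ⟨t, rfl⟩ := exists_two_rpow_neg hr
  refine ⟨Θ x (t + J), ⟨M x (t + J), h.det_ne _ _, h.eq _ _⟩, hin x t, (hout x t).trans ?_⟩
  have := hsub x (t + J)
  rwa [show t + J - (J + L) = t - L by ring] at this

theorem isAhlforsRegular (h : CoverBounds Θ M a₁ a₂ a₃ a₄ a₅ a₆) :
    IsAhlforsRegular (inducedDist Θ) := by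
  obtain ⟨J, hJ, hin⟩ := h.exists_subset_qball
  obtain ⟨L, hL, hout⟩ := h.exists_qball_subset
  have h1 := h.pos₁
  have h2 := h.pos₂
  refine ⟨max 1 (max (2 ^ J / a₁) (a₂ * 2 ^ L)), le_max_left _ _, fun x r hr => ?_⟩
  obtain ⟨t, rfl⟩ := exists_two_rpow_neg hr
  constructor
  · refine le_trans ?_ (measure_mono (hin x t))
    rw [ENNReal.ofReal_le_iff_le_toReal (h.volume_ne_top _ _)]
    refine le_trans ?_ (h.le_volume _ _)
    have hle : (2 : ℝ) ^ J / a₁ ≤ max 1 (max (2 ^ J / a₁) (a₂ * 2 ^ L)) :=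
      (le_max_left _ _).trans (le_max_right _ _)
    refine (div_le_div_of_nonneg_left (by positivity) (by positivity) hle).trans_eq ?_
    rw [neg_add, Real.rpow_add two_pos, Real.rpow_neg two_pos.le J]
    field_simp
  · refine (measure_mono (hout x t)).trans ?_
    rw [ENNReal.le_ofReal_iff_toReal_le (h.volume_ne_top _ _) (by positivity)]
    refine (h.volume_le _ _).trans ?_
    have hle : a₂ * 2 ^ L ≤ max 1 (max (2 ^ J / a₁) (a₂ * 2 ^ L)) :=
      (le_max_right _ _).trans (le_max_right _ _)
    refine le_trans (le_of_eq ?_) (mul_le_mul_of_nonneg_right hle (by positivity))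
    rw [neg_sub, sub_eq_add_neg, Real.rpow_add two_pos, mul_assoc]

theorem nullMeasurableSet_qball (h : CoverBounds Θ M a₁ a₂ a₃ a₄ a₅ a₆) (x : E n) (r : ℝ) :
    NullMeasurableSet (qball (inducedDist Θ) x r) volume := by
  have heq : qball (inducedDist Θ) x r =
      ⋃₀ {s | ∃ z t, s = Θ z t ∧ x ∈ Θ z t ∧ volume.real (Θ z t) < r} := by
    ext y
    simp only [qball, Set.mem_ofPred_eq, h.inducedDist_lt_iff, Set.mem_sUnion]
    constructor
    · rintro ⟨z, t, hx, hy, hr⟩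
      exact ⟨_, ⟨z, t, rfl, hx, hr⟩, hy⟩
    · rintro ⟨_, ⟨z, t, rfl, hx, hr⟩, hy⟩
      exact ⟨z, t, hx, hy, hr⟩
  rw [heq]
  refine nullMeasurableSet_sUnion_of_convex ?_ ?_
  · rintro _ ⟨z, t, rfl, -, -⟩
    rw [h.eq]
    exact convex_ellipsoid _ _
  · rintro _ ⟨z, t, rfl, -, -⟩ h0
    have := h.volume_pos z t
    rw [measureReal_def, h0] at this
    simp at this

end CoverBounds

/-! ### From a quasi-distance to a cover. -/

theorem matNorm_inv_mul_le (A B : Matrix (Fin n) (Fin n) ℝ) {D : Matrix (Fin n) (Fin n) ℝ}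
    (hD : D.det ≠ 0) : matNorm (A⁻¹ * B) ≤ matNorm (A⁻¹ * D) * matNorm (D⁻¹ * B) := by
  have h : A⁻¹ * B = (A⁻¹ * D) * (D⁻¹ * B) := by
    rw [Matrix.mul_assoc, ← Matrix.mul_assoc D, Matrix.mul_nonsing_inv _ hD.isUnit, Matrix.one_mul]
  rw [h]
  exact matNorm_mul_le _ _

theorem det_inv_mul_ne_zero {A B : Matrix (Fin n) (Fin n) ℝ} (hA : A.det ≠ 0) (hB : B.det ≠ 0) :
    (A⁻¹ * B).det ≠ 0 := by
  rw [Matrix.det_mul, Matrix.det_nonsing_inv, Ring.inverse_eq_inv']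
  exact mul_ne_zero (inv_ne_zero hA) hB

theorem inv_inv_mul {A B : Matrix (Fin n) (Fin n) ℝ} (hA : A.det ≠ 0) :
    (A⁻¹ * B)⁻¹ = B⁻¹ * A := by
  rw [Matrix.mul_inv_rev, Matrix.nonsing_inv_nonsing_inv _ hA.isUnit]

theorem abs_det_inv_mul (A B : Matrix (Fin n) (Fin n) ℝ) (x y : E n) :
    |(A⁻¹ * B).det| = volume.real (ellipsoid B y) / volume.real (ellipsoid A x) := by
  rw [volume_real_ellipsoid, volume_real_ellipsoid,
    mul_div_mul_right _ _ (volume_closedBall_real_pos n).ne', Matrix.det_mul,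
    Matrix.det_nonsing_inv, Ring.inverse_eq_inv', abs_mul, abs_inv, inv_mul_eq_div]

/-- A single point has finite volume, which contradicts linear growth for large `r`. -/
theorem IsAhlforsRegular.dim_ne_zero {ρ : E n → E n → ℝ} (h : IsAhlforsRegular ρ) : n ≠ 0 := by
  rintro rfl
  obtain ⟨c, hc, h⟩ := h
  have hfin : volume (Set.univ : Set (E 0)) ≠ ⊤ :=
    (Set.toFinite (Set.univ : Set (E 0))).isCompact.measure_lt_top.ne
  have hc0 : 0 < c := by linarith
  set r := c * (volume.real (Set.univ : Set (E 0)) + 1) with hr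
  have hr0 : 0 < r := by positivity
  have h1 := ((h 0 r hr0).1).trans (measure_mono (Set.subset_univ _))
  rw [ENNReal.ofReal_le_iff_le_toReal hfin, hr, mul_div_cancel_left₀ _ hc0.ne'] at h1
  exact absurd h1 (not_le.2 (lt_add_one _))

theorem qball_mono (ρ : E n → E n → ℝ) (x : E n) {r s : ℝ} (h : r ≤ s) :
    qball ρ x r ⊆ qball ρ x s := fun _ hy => lt_of_lt_of_le hy h

/-- Matrices and constants witnessing that the family `ξ` corresponds to the `1`-Ahlfors-regular
quasi-distance `ρ`. -/
structure DistBounds (ρ : E n → E n → ℝ) (ξ : E n → ℝ → Set (E n))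
    (M : E n → ℝ → Matrix (Fin n) (Fin n) ℝ) (κ c Q : ℝ) : Prop where
  quasi : IsQuasiDist ρ
  one_le_κ : 1 ≤ κ
  triangle : ∀ x y z, ρ x z ≤ κ * (ρ x y + ρ y z)
  one_le_c : 1 ≤ c
  le_volume_qball : ∀ x r, 0 < r → ENNReal.ofReal (r / c) ≤ volume (qball ρ x r)
  volume_qball_le : ∀ x r, 0 < r → volume (qball ρ x r) ≤ ENNReal.ofReal (c * r)
  one_le_Q : 1 ≤ Q
  det_ne : ∀ x r, 0 < r → (M x r).det ≠ 0
  eq : ∀ x r, 0 < r → ξ x r = ellipsoid (M x r) x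
  subset : ∀ x r, 0 < r → ξ x r ⊆ qball ρ x r
  subset_dilate : ∀ x r, 0 < r → qball ρ x r ⊆ dilate x Q (ξ x r)

theorem IsCorrespondingFamily.exists_bounds {ρ : E n → E n → ℝ} {ξ : E n → ℝ → Set (E n)}
    (hξ : IsCorrespondingFamily ρ ξ) (hρ : IsQuasiDist ρ) (hA : IsAhlforsRegular ρ) :
    ∃ M κ c Q, DistBounds ρ ξ M κ c Q := by
  obtain ⟨Q, hQ, hξ⟩ := hξ
  obtain ⟨κ, hκ, htri⟩ := hρ.triangle
  obtain ⟨c, hc, hA⟩ := hA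
  have hM : ∀ x r, ∃ M : Matrix (Fin n) (Fin n) ℝ, 0 < r → M.det ≠ 0 ∧ ξ x r = ellipsoid M x := by
    intro x r
    by_cases hr : 0 < r
    · obtain ⟨M, hM⟩ := (hξ x r hr).1
      exact ⟨M, fun _ => hM⟩
    · exact ⟨0, fun h => absurd h hr⟩
  choose M hM using hM
  exact ⟨M, κ, c, Q, hρ, hκ, htri, hc, fun x r hr => (hA x r hr).1, fun x r hr => (hA x r hr).2,
    hQ, fun x r hr => (hM x r hr).1, fun x r hr => (hM x r hr).2, fun x r hr => (hξ x r hr).2.1,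
    fun x r hr => (hξ x r hr).2.2⟩

namespace DistBounds

variable {ρ : E n → E n → ℝ} {ξ : E n → ℝ → Set (E n)}
  {M : E n → ℝ → Matrix (Fin n) (Fin n) ℝ} {κ c Q : ℝ}

theorem self_mem_qball (h : DistBounds ρ ξ M κ c Q) (x : E n) {r : ℝ} (hr : 0 < r) :
    x ∈ qball ρ x r := by
  simpa [qball, (h.quasi.eq_zero_iff x x).2 rfl] using hr

theorem c_pos (h : DistBounds ρ ξ M κ c Q) : 0 < c := one_pos.trans_le h.one_le_c

theorem Q_pos (h : DistBounds ρ ξ M κ c Q) : 0 < Q := one_pos.trans_le h.one_le_Q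

theorem three_le (h : DistBounds ρ ξ M κ c Q) : 3 ≤ 3 * κ ^ 2 := by
  nlinarith [one_le_pow₀ h.one_le_κ (n := 2)]

/-- Engulfing of a smaller ball by a larger one it meets: two triangle inequalities give `κ (r + 2κ
r) ≤ 3 κ² r`. -/
theorem qball_subset (h : DistBounds ρ ξ M κ c Q) {x y : E n} {r s : ℝ} (hsr : s ≤ r)
    (hne : (qball ρ x r ∩ qball ρ y s).Nonempty) : qball ρ y s ⊆ qball ρ x (3 * κ ^ 2 * r) := by
  obtain ⟨w, hwx, hwy⟩ := hne
  intro z hz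
  simp only [qball, Set.mem_ofPred_eq] at *
  have hκ := h.one_le_κ
  have hr : 0 ≤ r := (h.quasi.nonneg x w).trans hwx.le
  have h1 := h.triangle x w z
  have h2 := h.triangle w y z
  rw [h.quasi.symm w y] at h2
  have h3 : ρ w z < κ * (2 * r) := h2.trans_lt (by gcongr; linarith)
  calc ρ x z ≤ κ * (ρ x w + ρ w z) := h1
    _ < κ * (r + κ * (2 * r)) := by gcongr
    _ ≤ κ * (κ * r + κ * (2 * r)) := by
        gcongr
        exact le_mul_of_one_le_left hr hκ
    _ = _ := by ring

theorem volume_le (h : DistBounds ρ ξ M κ c Q) (x : E n) {r : ℝ} (hr : 0 < r) :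
    volume.real (ξ x r) ≤ c * r := by
  refine ENNReal.toReal_le_of_le_ofReal (mul_pos h.c_pos hr).le ?_
  exact (measure_mono (h.subset x r hr)).trans (h.volume_qball_le x r hr)

theorem le_volume (h : DistBounds ρ ξ M κ c Q) (x : E n) {r : ℝ} (hr : 0 < r) :
    (c * Q ^ n)⁻¹ * r ≤ volume.real (ξ x r) := by
  have hc := h.c_pos
  have hQ := h.Q_pos
  have h1 := (h.le_volume_qball x r hr).trans (measure_mono (h.subset_dilate x r hr))
  rw [h.eq x r hr, ENNReal.ofReal_le_iff_le_toReal
    (by rw [dilate_ellipsoid]; exact volume_ellipsoid_ne_top _ _), ← measureReal_def,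
    volume_real_dilate_ellipsoid _ _ hQ.le, ← h.eq x r hr, div_le_iff₀ hc] at h1
  rw [inv_mul_le_iff₀ (by positivity)]
  linarith

theorem abs_det_le (h : DistBounds ρ ξ M κ c Q) (x y : E n) {r s : ℝ} (hr : 0 < r) (hs : 0 < s) :
    |((M x r)⁻¹ * M y s).det| ≤ c ^ 2 * Q ^ n * (s / r) := by
  have hc := h.c_pos
  have hQ := h.Q_pos
  rw [abs_det_inv_mul _ _ x y, ← h.eq x r hr, ← h.eq y s hs]
  have h1 := h.le_volume x hr
  refine (div_le_div₀ (by positivity) (h.volume_le y hs) (by positivity) h1).trans_eq ?_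
  field_simp

theorem matNorm_le_of_subset (h : DistBounds ρ ξ M κ c Q) {x y : E n} {r s : ℝ} (hr : 0 < r)
    (hs : 0 < s) (hsub : qball ρ y s ⊆ qball ρ x r) : matNorm ((M x r)⁻¹ * M y s) ≤ Q := by
  refine matNorm_le_of_ellipsoid_subset h.Q_pos (h.det_ne x r hr) (h.det_ne y s hs)
    (x := x) (y := y) ?_
  rw [← h.eq x r hr, ← h.eq y s hs]
  exact (h.subset y s hs).trans (hsub.trans (h.subset_dilate x r hr))

/-- Ellipsoids of a finer scale are bounded in the shape of the coarser ellipsoids near them. -/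
theorem exists_matNorm_le (h : DistBounds ρ ξ M κ c Q) : ∃ C : ℝ, 0 < C ∧
    ∀ x y r s, 0 < s → s ≤ r → (qball ρ x r ∩ qball ρ y s).Nonempty →
      matNorm ((M x r)⁻¹ * M y s) ≤ C := by
  obtain ⟨C, hC, hle⟩ := exists_matNorm_le_mul_abs_det n Q
  have hc := h.c_pos
  have hQ := h.Q_pos
  have hK := h.three_le
  have hK0 : 0 < 3 * κ ^ 2 := by linarith
  refine ⟨C * (c ^ 2 * Q ^ n * (3 * κ ^ 2)) * Q, by positivity, fun x y r s hs hsr hne => ?_⟩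
  have hr : 0 < r := hs.trans_le hsr
  have hR : 0 < 3 * κ ^ 2 * r := mul_pos hK0 hr
  have hDx := h.det_ne x r hr
  have hDX := h.det_ne x _ hR
  -- Pass through the ellipsoid at `x` of radius `3κ²r`, whose ball contains both balls. The
  -- inclusion of `B(y, s)` bounds one factor by `Q`; for the other, that of `B(x, r)` bounds the
  -- inverse and regularity bounds the determinant.
  refine (matNorm_inv_mul_le _ _ hDX).trans ?_
  have h1 := h.matNorm_le_of_subset hR hs (h.qball_subset hsr hne)
  have h2 : matNorm ((M x r)⁻¹ * M x (3 * κ ^ 2 * r))⁻¹ ≤ Q := by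
    rw [inv_inv_mul hDx]
    exact h.matNorm_le_of_subset hR hr (qball_mono ρ x (by nlinarith))
  have h3 := hle _ (det_inv_mul_ne_zero hDx hDX) h2
  have h4 := h.abs_det_le x x hr hR
  rw [mul_div_cancel_right₀ _ hr.ne'] at h4
  have h5 := matNorm_nonneg ((M x (3 * κ ^ 2 * r))⁻¹ * M y s)
  gcongr
  exact h3.trans (by gcongr)

/-- A ball contains translates, around all points of a comparable smaller ball, of a fixed portion
of the ellipsoid at its center. -/
theorem exists_add_smul_mem (h : DistBounds ρ ξ M κ c Q) : ∃ δ : ℝ, 0 < δ ∧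
    ∀ y z v r R, 0 < r → r ≤ R → z ∈ qball ρ y R → ‖opOf (M y r)⁻¹ v‖ ≤ 1 →
      z + δ • v ∈ qball ρ y (3 * κ ^ 2 * R) := by
  obtain ⟨C, hC, hle⟩ := h.exists_matNorm_le
  refine ⟨C⁻¹, inv_pos.2 hC, fun y z v r R hr hrR hz hv => ?_⟩
  have hR : 0 < R := hr.trans_le hrR
  have hzz := h.self_mem_qball z hR
  -- By the choice of `δ`, the point `z + δ • v` already lies in the ellipsoid at `z` of radius `R`.
  refine h.qball_subset le_rfl ⟨z, hz, hzz⟩ (h.subset z R hR ?_)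
  rw [h.eq z R hR, mem_ellipsoid (h.det_ne z R hR), add_sub_cancel_left, map_smul, norm_smul,
    Real.norm_eq_abs, abs_of_pos (inv_pos.2 hC), inv_mul_le_iff₀ hC, mul_one]
  have hy : y ∈ qball ρ z R := by
    simpa [qball, h.quasi.symm z y] using hz
  have h1 := hle z y R r hr hrR ⟨y, hy, h.self_mem_qball y hr⟩
  refine (norm_opOf_inv_le _ (h.det_ne y r hr) v).trans ?_
  exact (mul_le_mul h1 hv (norm_nonneg _) hC.le).trans_eq (mul_one C)

/-- Walk `j` steps `δ • v` from `y`, each costing a factor `3κ²` in the radius. The end point lies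
in the `Q`-dilate of the large ellipsoid, so `v` has norm at most `Q / (jδ) ≤ 1/2` there. -/
theorem exists_matNorm_le_half (h : DistBounds ρ ξ M κ c Q) : ∃ L : ℝ, 1 < L ∧
    ∀ y r, 0 < r → matNorm ((M y (L * r))⁻¹ * M y r) ≤ 1 / 2 := by
  obtain ⟨δ, hδ, hstep⟩ := h.exists_add_smul_mem
  have hQ := h.Q_pos
  have hK : 1 < 3 * κ ^ 2 := by linarith [h.three_le]
  obtain ⟨j, hj⟩ := exists_nat_ge (2 * Q / δ)
  rw [div_le_iff₀ hδ] at hj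
  have hjδ : 0 < (j : ℝ) * δ := by linarith
  have hj0 : j ≠ 0 := by
    rintro rfl
    simp at hjδ
  refine ⟨(3 * κ ^ 2) ^ j, one_lt_pow₀ hK hj0, fun y r hr => ?_⟩
  have hR : 0 < (3 * κ ^ 2) ^ j * r := by positivity
  refine matNorm_le_of_forall (by norm_num) (h.det_ne y r hr) fun v hv => ?_
  have hind : ∀ i : ℕ, y + ((i : ℝ) * δ) • v ∈ qball ρ y ((3 * κ ^ 2) ^ i * r) := by
    intro i
    induction i with
    | zero => simpa using h.self_mem_qball y hr
    | succ i ih =>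
      have h1 := hstep y _ v r _ hr (le_mul_of_one_le_left hr.le (one_le_pow₀ hK.le)) ih hv
      rw [add_assoc, ← add_smul, ← mul_assoc, ← pow_succ'] at h1
      convert h1 using 3
      push_cast
      ring
  have h1 := h.subset_dilate y _ hR (hind j)
  rw [h.eq y _ hR, mem_dilate_ellipsoid (h.det_ne y _ hR) hQ, add_sub_cancel_left, map_smul,
    norm_smul, Real.norm_eq_abs, abs_of_pos hjδ] at h1
  nlinarith [norm_nonneg (opOf (M y ((3 * κ ^ 2) ^ j * r))⁻¹ v)]

theorem exists_matNorm_le_half_pow (h : DistBounds ρ ξ M κ c Q) : ∃ L : ℝ, 1 < L ∧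
    ∀ y r, 0 < r → ∀ k : ℕ, matNorm ((M y (L ^ k * r))⁻¹ * M y r) ≤ (1 / 2) ^ k := by
  obtain ⟨L, hL, hle⟩ := h.exists_matNorm_le_half
  have hL0 : 0 < L := by linarith
  refine ⟨L, hL, fun y r hr k => ?_⟩
  induction k with
  | zero =>
    rw [pow_zero, pow_zero, one_mul]
    exact matNorm_le_of_forall zero_le_one (h.det_ne y r hr) fun v hv => hv
  | succ k ih =>
    have hk : 0 < L ^ k * r := by positivity
    have h1 := hle y _ hk
    rw [← mul_assoc, ← pow_succ'] at h1
    refine (matNorm_inv_mul_le _ _ (h.det_ne y _ hk)).trans ?_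
    rw [pow_succ' (1 / 2 : ℝ)]
    exact mul_le_mul h1 ih (matNorm_nonneg _) (by norm_num)

/-- Grow `B(y, s)` concentrically by the largest power `L ^ k` that keeps its radius below `r`,
gaining `2 ^ (-k)`; then compare with the ellipsoid at `x` at the cost of `C`. -/
theorem exists_matNorm_le_rpow (h : DistBounds ρ ξ M κ c Q) : ∃ a b : ℝ, 0 < a ∧ 0 < b ∧
    ∀ x y r s, 0 < s → s ≤ r → (qball ρ x r ∩ qball ρ y s).Nonempty →
      matNorm ((M x r)⁻¹ * M y s) ≤ a * (s / r) ^ b := by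
  obtain ⟨C, hC, hcmp⟩ := h.exists_matNorm_le
  obtain ⟨L, hL, hpow⟩ := h.exists_matNorm_le_half_pow
  have hL0 : 0 < L := by linarith
  have hb : 0 < Real.logb L 2 := Real.logb_pos hL one_lt_two
  refine ⟨2 * C, Real.logb L 2, by positivity, hb, fun x y r s hs hsr hne => ?_⟩
  have hr : 0 < r := hs.trans_le hsr
  obtain ⟨k, hk1, hk2⟩ := exists_nat_pow_near ((one_le_div hs).2 hsr) hL
  have hk : 0 < L ^ k * s := by positivity
  have hkr : L ^ k * s ≤ r := (le_div_iff₀ hs).1 hk1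
  have hmono : qball ρ y s ⊆ qball ρ y (L ^ k * s) :=
    qball_mono ρ y (le_mul_of_one_le_left hs.le (one_le_pow₀ hL.le))
  have h1 := hcmp x y r _ hk hkr (hne.mono (Set.inter_subset_inter_right _ hmono))
  have h2 := hpow y s hs k
  -- The factor 2 pays for rounding: only `L ^ (k + 1)` exceeds `r / s`, and `L` to the power `logb
  -- L 2` is 2.
  have h3 : (1 / 2 : ℝ) ^ k ≤ 2 * (s / r) ^ Real.logb L 2 := by
    have h4 : (L ^ (k + 1))⁻¹ ≤ s / r := by
      rw [← inv_div r s]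
      exact inv_anti₀ (by positivity) hk2.le
    have h5 := Real.rpow_le_rpow (by positivity) h4 hb.le
    have h6 : ((L ^ (k + 1))⁻¹) ^ Real.logb L 2 = (1 / 2 : ℝ) ^ (k + 1) := by
      rw [Real.inv_rpow (by positivity), ← Real.rpow_natCast, ← Real.rpow_mul hL0.le, mul_comm,
        Real.rpow_mul hL0.le, Real.rpow_logb hL0 hL.ne' two_pos, Real.rpow_natCast, one_div,
        inv_pow]
    rw [h6, pow_succ] at h5
    linarith
  calc matNorm ((M x r)⁻¹ * M y s) ≤ _ := matNorm_inv_mul_le _ _ (h.det_ne y _ hk)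
    _ ≤ C * (1 / 2) ^ k := mul_le_mul h1 h2 (matNorm_nonneg _) hC.le
    _ ≤ C * (2 * (s / r) ^ Real.logb L 2) := by gcongr
    _ = _ := by ring

theorem isContinuousCover (h : DistBounds ρ ξ M κ c Q) (hn : n ≠ 0) :
    IsContinuousCover (byScale ξ) := by
  obtain ⟨a, b, ha, hb, hle⟩ := h.exists_matNorm_le_rpow
  obtain ⟨C, hC, hdet⟩ := exists_matNorm_le_mul_abs_det n a
  have hc := h.c_pos
  have hQ := h.Q_pos
  have hp : ∀ t : ℝ, (0 : ℝ) < 2 ^ (-t) := fun t => by positivity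
  refine ⟨(c * Q ^ n)⁻¹, c, (C * (c ^ 2 * Q ^ n))⁻¹, 1, a, b, by positivity, hc, by positivity,
    one_pos, ha, hb, fun x t => M x (2 ^ (-t)), fun x t => ⟨h.det_ne x _ (hp t), h.eq x _ (hp t),
      h.le_volume x (hp t), h.volume_le x (hp t)⟩, fun x y t s hs hne => ?_⟩
  have hDx := h.det_ne x _ (hp t)
  have hDy := h.det_ne y _ (hp (t + s))
  have hratio : (2 : ℝ) ^ (-(t + s)) / 2 ^ (-t) = 2 ^ (-s) := by
    rw [← Real.rpow_sub two_pos]; congr 1; ring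
  have hratio' : (2 : ℝ) ^ (-t) / 2 ^ (-(t + s)) = 2 ^ s := by
    rw [← Real.rpow_sub two_pos]; congr 1; ring
  have hmeet := hne.mono (Set.inter_subset_inter (h.subset x _ (hp t)) (h.subset y _ (hp (t + s))))
  have hst : (2 : ℝ) ^ (-(t + s)) ≤ 2 ^ (-t) :=
    Real.rpow_le_rpow_of_exponent_le one_le_two (by linarith)
  have h1 := hle x y _ _ (hp (t + s)) hst hmeet
  rw [hratio, ← Real.rpow_mul two_pos.le, show -s * b = -(b * s) by ring] at h1
  have h2 := one_le_matNorm_mul_matNorm hn hDx hDy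
  have hN1 := matNorm_nonneg ((M x (2 ^ (-t)))⁻¹ * M y (2 ^ (-(t + s))))
  have hN2 : 0 < matNorm ((M y (2 ^ (-(t + s))))⁻¹ * M x (2 ^ (-t))) :=
    pos_of_mul_pos_right (one_pos.trans_le h2) hN1
  refine ⟨?_, (div_le_iff₀ hN2).2 h2, h1⟩
  -- The fine bound controls the inverse by `a`, and the determinant is at most a constant times the
  -- radius ratio `2 ^ s`; hence the exponent `a₄ = 1`.
  have h3 : matNorm ((M y (2 ^ (-(t + s))))⁻¹ * M x (2 ^ (-t))) ≤ C * (c ^ 2 * Q ^ n * 2 ^ s) := by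
    refine (hdet _ (det_inv_mul_ne_zero hDy hDx) ?_).trans ?_
    · rw [inv_inv_mul hDy]
      refine h1.trans (mul_le_of_le_one_right ha.le ?_)
      exact Real.rpow_le_one_of_one_le_of_nonpos one_le_two (by nlinarith [mul_nonneg hb.le hs])
    · gcongr
      have := h.abs_det_le y x (hp (t + s)) (hp t)
      rwa [hratio'] at this
  rw [one_mul, le_one_div (by positivity) hN2]
  refine h3.trans_eq ?_
  rw [Real.rpow_neg two_pos.le, one_div, mul_inv, inv_inv, inv_inv]
  ring

/-- For each `r > ρ x y`, the `Q`-dilate of `ξ x r` contains `y` and sits in one ellipsoid of volume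
at most a constant times `r`. Conversely, two points of `ξ z r` are within `2κr`, and `r` is at most
`c * Q ^ n` times its volume. -/
theorem distEquiv (h : DistBounds ρ ξ M κ c Q) (hn : n ≠ 0) :
    DistEquiv (inducedDist (byScale ξ)) ρ := by
  obtain ⟨M', a₁, a₂, a₃, a₄, a₅, a₆, h'⟩ := (h.isContinuousCover hn).exists_bounds
  have hc := h.c_pos
  have hQ := h.Q_pos
  have hκ0 : 0 < κ := one_pos.trans_le h.one_le_κ
  have ha₂ := h'.pos₂
  obtain ⟨J, -, hJ⟩ := h'.exists_dilate_subset hQ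
  set C₁ := a₂ * 2 ^ J with hC₁
  set C₂ := 2 * κ * (c * Q ^ n) with hC₂
  have hlow : ∀ x y, inducedDist (byScale ξ) x y ≤ C₁ * ρ x y := by
    intro x y
    rw [mul_comm, ← div_le_iff₀ (by positivity)]
    refine le_of_forall_gt_imp_ge_of_dense fun r hr => ?_
    have hr0 : 0 < r := (h.quasi.nonneg x y).trans_lt hr
    obtain ⟨t, rfl⟩ := exists_two_rpow_neg hr0
    have hy : y ∈ byScale ξ x (t - J) := hJ x t (h.subset_dilate x _ hr0 hr)
    rw [div_le_iff₀ (by positivity)]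
    refine (inducedDist_le _ (h'.center_mem x _) hy).trans ((h'.volume_le x _).trans_eq ?_)
    rw [hC₁, neg_sub, sub_eq_add_neg, Real.rpow_add two_pos]
    ring
  have hupp : ∀ x y, ρ x y ≤ C₂ * inducedDist (byScale ξ) x y := by
    intro x y
    refine h'.le_mul_inducedDist (by positivity) fun z t hx hy => ?_
    have hr0 : (0 : ℝ) < 2 ^ (-t) := by positivity
    have hx' : ρ z x < 2 ^ (-t) := h.subset z _ hr0 hx
    have hy' : ρ z y < 2 ^ (-t) := h.subset z _ hr0 hy
    have h1 := h.triangle x z y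
    rw [h.quasi.symm x z] at h1
    have h2 : (2 : ℝ) ^ (-t) ≤ c * Q ^ n * volume.real (byScale ξ z t) := by
      rw [← inv_mul_le_iff₀ (by positivity)]
      exact h.le_volume z hr0
    calc ρ x y ≤ κ * (ρ z x + ρ z y) := h1
      _ ≤ κ * (2 * (c * Q ^ n * volume.real (byScale ξ z t))) := by gcongr; linarith
      _ = _ := by rw [hC₂]; ring
  refine ⟨max 1 (max C₁ C₂), le_max_left _ _, fun x y => ⟨(hlow x y).trans ?_, (hupp x y).trans ?_⟩⟩
  · exact mul_le_mul_of_nonneg_right ((le_max_left _ _).trans (le_max_right _ _))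
      (h.quasi.nonneg x y)
  · exact mul_le_mul_of_nonneg_right ((le_max_right _ _).trans (le_max_right _ _))
      (inducedDist_nonneg _ x y)

end DistBounds

/-! ### Equivalence classes and the bijection. -/

theorem CoverBounds.dilate_subset_dilate {Θ : E n → ℝ → Set (E n)}
    {M : E n → ℝ → Matrix (Fin n) (Fin n) ℝ} {a₁ a₂ a₃ a₄ a₅ a₆ : ℝ}
    (h : CoverBounds Θ M a₁ a₂ a₃ a₄ a₅ a₆) {C D : ℝ} (hC : 0 < C) (hCD : C ≤ D) (x : E n) (t : ℝ) :
    dilate x C (Θ x t) ⊆ dilate x D (Θ x t) := fun _ hz =>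
  (h.mem_dilate_iff (hC.trans_le hCD)).2 (((h.mem_dilate_iff hC).1 hz).trans hCD)

theorem coverEquiv_of_subset {Θ Θ' : E n → ℝ → Set (E n)} (hΘ : IsContinuousCover Θ)
    (hΘ' : IsContinuousCover Θ') (h : ∃ C : ℝ, 1 ≤ C ∧ ∀ x t, Θ x t ⊆ dilate x C (Θ' x t))
    (h' : ∃ C : ℝ, 1 ≤ C ∧ ∀ x t, Θ' x t ⊆ dilate x C (Θ x t)) : CoverEquiv Θ Θ' := by
  obtain ⟨M, a₁, a₂, a₃, a₄, a₅, a₆, hb⟩ := hΘ.exists_bounds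
  obtain ⟨M', b₁, b₂, b₃, b₄, b₅, b₆, hb'⟩ := hΘ'.exists_bounds
  obtain ⟨C, hC, h⟩ := h
  obtain ⟨D, hD, h'⟩ := h'
  exact ⟨max C D, hC.trans (le_max_left _ _), fun x t =>
    ⟨(h x t).trans (hb'.dilate_subset_dilate (one_pos.trans_le hC) (le_max_left _ _) x t),
      (h' x t).trans (hb.dilate_subset_dilate (one_pos.trans_le hD) (le_max_right _ _) x t)⟩⟩

theorem exists_inducedDist_le_of_subset {Θ Θ' : E n → ℝ → Set (E n)} (hΘ : IsContinuousCover Θ)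
    (hΘ' : IsContinuousCover Θ') {C : ℝ} (hC : 0 < C)
    (h : ∀ x t, Θ x t ⊆ dilate x C (Θ' x t)) :
    ∃ D : ℝ, 0 < D ∧ ∀ x y, inducedDist Θ' x y ≤ D * inducedDist Θ x y := by
  obtain ⟨M, a₁, a₂, a₃, a₄, a₅, a₆, hb⟩ := hΘ.exists_bounds
  obtain ⟨M', b₁, b₂, b₃, b₄, b₅, b₆, hb'⟩ := hΘ'.exists_bounds
  obtain ⟨J, -, hJ⟩ := hb'.exists_dilate_subset hC
  have h1 := hb.pos₁
  have h2 := hb'.pos₂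
  have hD : 0 < b₂ * 2 ^ J / a₁ := by positivity
  refine ⟨_, hD, fun x y => hb.le_mul_inducedDist hD fun z t hx hy => ?_⟩
  exact (inducedDist_le Θ' (hJ z t (h z t hx)) (hJ z t (h z t hy))).trans
    (hb.volume_sub_le hb' z z t J)

theorem CoverEquiv.distEquiv_inducedDist {Θ Θ' : E n → ℝ → Set (E n)} (h : CoverEquiv Θ Θ')
    (hΘ : IsContinuousCover Θ) (hΘ' : IsContinuousCover Θ') :
    DistEquiv (inducedDist Θ) (inducedDist Θ') := by
  obtain ⟨C, hC, h⟩ := h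
  have hC0 : 0 < C := by linarith
  obtain ⟨D, hD, hle⟩ := exists_inducedDist_le_of_subset hΘ hΘ' hC0 fun x t => (h x t).1
  obtain ⟨D', hD', hle'⟩ := exists_inducedDist_le_of_subset hΘ' hΘ hC0 fun x t => (h x t).2
  refine ⟨max 1 (max D D'), le_max_left _ _, fun x y => ⟨(hle' x y).trans ?_, (hle x y).trans ?_⟩⟩
  · exact mul_le_mul_of_nonneg_right ((le_max_right _ _).trans (le_max_right _ _))
      (inducedDist_nonneg _ x y)
  · exact mul_le_mul_of_nonneg_right ((le_max_left _ _).trans (le_max_right _ _))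
      (inducedDist_nonneg _ x y)

/-- The factor `C` between the distances is a scale shift by `logb 2 C`, which the target cover
absorbs in a dilation. -/
theorem exists_byScale_subset_dilate {ρ ρ' : E n → E n → ℝ} {ξ ξ' : E n → ℝ → Set (E n)}
    (hξ : IsCorrespondingFamily ρ ξ) (hξ' : IsCorrespondingFamily ρ' ξ')
    (hcov : IsContinuousCover (byScale ξ')) (hρ : DistEquiv ρ ρ') :
    ∃ C : ℝ, 1 ≤ C ∧ ∀ x t, byScale ξ x t ⊆ dilate x C (byScale ξ' x t) := by
  obtain ⟨M, a₁, a₂, a₃, a₄, a₅, a₆, hb⟩ := hcov.exists_bounds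
  obtain ⟨Q, -, hξ⟩ := hξ
  obtain ⟨Q', hQ', hξ'⟩ := hξ'
  obtain ⟨C, hC, hρ⟩ := hρ
  have hC0 : 0 < C := by linarith
  set J := Real.logb 2 C with hJ
  have hCJ : (2 : ℝ) ^ J = C := Real.rpow_logb two_pos (by norm_num) hC0
  obtain ⟨D, hD, hsub⟩ := hb.exists_subset_dilate (Real.logb_nonneg one_lt_two hC)
  refine ⟨Q' * D, one_le_mul_of_one_le_of_one_le hQ' hD, fun x t => ?_⟩
  have hp : ∀ t : ℝ, (0 : ℝ) < 2 ^ (-t) := fun t => by positivity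
  have hball : qball ρ x (2 ^ (-t)) ⊆ qball ρ' x (2 ^ (-(t - J))) := by
    intro y hy
    have : (2 : ℝ) ^ (-(t - J)) = C * 2 ^ (-t) := by
      rw [neg_sub, sub_eq_add_neg, Real.rpow_add two_pos, hCJ]
    simp only [qball, Set.mem_ofPred_eq] at *
    rw [this]
    exact (hρ x y).2.trans_lt (by gcongr)
  rw [← dilate_dilate]
  exact (hξ x _ (hp t)).2.1.trans (hball.trans ((hξ' x _ (hp (t - J))).2.2.trans
    (dilate_mono x Q' (hsub x t))))

/-- Both covers sandwich the same balls of `inducedDist Θ`. -/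
theorem coverEquiv_byScale_inducedDist {Θ ξ : E n → ℝ → Set (E n)} (hΘ : IsContinuousCover Θ)
    (hξ : IsCorrespondingFamily (inducedDist Θ) ξ) (hcov : IsContinuousCover (byScale ξ)) :
    CoverEquiv (byScale ξ) Θ := by
  obtain ⟨M, a₁, a₂, a₃, a₄, a₅, a₆, hb⟩ := hΘ.exists_bounds
  obtain ⟨J, hJ, hin⟩ := hb.exists_subset_qball
  obtain ⟨L, hL, hout⟩ := hb.exists_qball_subset
  obtain ⟨C, hC, hCsub⟩ := hb.exists_subset_dilate hL
  obtain ⟨D, hD, hDsub⟩ := hb.exists_subset_dilate hJ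
  obtain ⟨Q, hQ, hξ⟩ := hξ
  have hp : ∀ t : ℝ, (0 : ℝ) < 2 ^ (-t) := fun t => by positivity
  refine coverEquiv_of_subset hcov hΘ ⟨C, hC, fun x t => ?_⟩
    ⟨D * Q, one_le_mul_of_one_le_of_one_le hD hQ, fun x t => ?_⟩
  · exact (hξ x _ (hp t)).2.1.trans ((hout x t).trans (hCsub x t))
  · rw [← dilate_dilate]
    have h1 := hDsub x (t + J)
    rw [add_sub_cancel_right] at h1
    exact h1.trans (dilate_mono x D ((hin x t).trans (hξ x _ (hp t)).2.2))

theorem IsContinuousCover.regular {Θ : E n → ℝ → Set (E n)} (hΘ : IsContinuousCover Θ) :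
    IsQuasiDist (inducedDist Θ) ∧ IsQuasiConvex (inducedDist Θ) ∧
      IsAhlforsRegular (inducedDist Θ) := by
  obtain ⟨M, a₁, a₂, a₃, a₄, a₅, a₆, hb⟩ := hΘ.exists_bounds
  exact ⟨hb.isQuasiDist, hb.isQuasiConvex, hb.isAhlforsRegular⟩

theorem IsQuasiConvex.exists_correspondingFamily {ρ : E n → E n → ℝ} (h : IsQuasiConvex ρ) :
    ∃ ξ, IsCorrespondingFamily ρ ξ := by
  obtain ⟨Q, hQ, h⟩ := h
  have h' : ∀ x r, ∃ ξ : Set (E n), 0 < r → IsQuasiConvexWitness Q x (qball ρ x r) ξ := by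
    intro x r
    by_cases hr : 0 < r
    · obtain ⟨ξ, hξ⟩ := h x r hr
      exact ⟨ξ, fun _ => hξ⟩
    · exact ⟨∅, fun h => absurd h hr⟩
  choose ξ hξ using h'
  exact ⟨ξ, Q, hQ, hξ⟩

theorem IsCorrespondingFamily.isContinuousCover {ρ : E n → E n → ℝ} {ξ : E n → ℝ → Set (E n)}
    (hξ : IsCorrespondingFamily ρ ξ) (hρ : IsQuasiDist ρ) (hA : IsAhlforsRegular ρ) :
    IsContinuousCover (byScale ξ) := by
  obtain ⟨M, κ, c, Q, h⟩ := hξ.exists_bounds hρ hA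
  exact h.isContinuousCover hA.dim_ne_zero

theorem IsCorrespondingFamily.distEquiv {ρ : E n → E n → ℝ} {ξ : E n → ℝ → Set (E n)}
    (hξ : IsCorrespondingFamily ρ ξ) (hρ : IsQuasiDist ρ) (hA : IsAhlforsRegular ρ) :
    DistEquiv (inducedDist (byScale ξ)) ρ := by
  obtain ⟨M, κ, c, Q, h⟩ := hξ.exists_bounds hρ hA
  exact h.distEquiv hA.dim_ne_zero

/-- The quasi-distance induced by a cover. -/
noncomputable def Cover.toDist (Θ : Cover n) : RegularDist n :=
  ⟨inducedDist Θ.1, Θ.2.regular⟩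

/-- A chosen family of ellipsoids corresponding to a quasi-distance. -/
noncomputable def RegularDist.family (ρ : RegularDist n) : E n → ℝ → Set (E n) :=
  ρ.2.2.1.exists_correspondingFamily.choose

theorem RegularDist.isCorrespondingFamily_family (ρ : RegularDist n) :
    IsCorrespondingFamily ρ.1 ρ.family :=
  ρ.2.2.1.exists_correspondingFamily.choose_spec

/-- The cover given by a chosen family of ellipsoids corresponding to a quasi-distance. -/
noncomputable def RegularDist.toCover (ρ : RegularDist n) : Cover n :=
  ⟨byScale ρ.family, ρ.isCorrespondingFamily_family.isContinuousCover ρ.2.1 ρ.2.2.2⟩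

/-- The class of the cover depends neither on the chosen family nor on the representative distance.
-/
theorem RegularDist.coverEquiv_toCover {ρ ρ' : RegularDist n} {ξ : E n → ℝ → Set (E n)}
    (hξ : IsCorrespondingFamily ρ.1 ξ) (h : DistEquiv ρ.1 ρ'.1) :
    CoverEquiv (byScale ξ) ρ'.toCover.1 :=
  have hcov := hξ.isContinuousCover ρ.2.1 ρ.2.2.2
  have hξ' := ρ'.isCorrespondingFamily_family
  coverEquiv_of_subset hcov ρ'.toCover.2 (exists_byScale_subset_dilate hξ hξ' ρ'.toCover.2 h)
    (exists_byScale_subset_dilate hξ' hξ hcov h.symm)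

/-- The correspondence between classes of continuous ellipsoid covers and classes of
quasi-convex, `1`-Ahlfors-regular quasi-distances. -/
noncomputable def coverEquivDist (n : ℕ) :
    Quotient (coverSetoid n) ≃ Quotient (distSetoid n) where
  toFun := Quotient.map Cover.toDist fun Θ Θ' h => h.distEquiv_inducedDist Θ.2 Θ'.2
  invFun := Quotient.map RegularDist.toCover fun ρ _ h =>
    RegularDist.coverEquiv_toCover ρ.isCorrespondingFamily_family h
  left_inv := by
    rintro ⟨Θ⟩
    exact Quotient.sound (coverEquiv_byScale_inducedDist Θ.2
      Θ.toDist.isCorrespondingFamily_family Θ.toDist.toCover.2)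
  right_inv := by
    rintro ⟨ρ⟩
    exact Quotient.sound (ρ.isCorrespondingFamily_family.distEquiv ρ.2.1 ρ.2.2.2)

end EllipsoidCover

theorem theorem4p9 (n : ℕ) :
    -- Part (i)
    (∀ Θ : E n → ℝ → Set (E n), IsContinuousCover Θ →
      IsQuasiDist (inducedDist Θ) ∧ IsQuasiConvex (inducedDist Θ) ∧
      (∀ (x : E n) (r : ℝ), NullMeasurableSet (qball (inducedDist Θ) x r) volume) ∧
      IsAhlforsRegular (inducedDist Θ)) ∧
    -- Part (ii)
    (∀ ρ : E n → E n → ℝ, IsQuasiDist ρ → IsQuasiConvex ρ → IsAhlforsRegular ρ →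
      (∃ ξ : E n → ℝ → Set (E n), IsCorrespondingFamily ρ ξ) ∧
      ∀ ξ : E n → ℝ → Set (E n), IsCorrespondingFamily ρ ξ →
        IsContinuousCover (byScale ξ) ∧ DistEquiv (inducedDist (byScale ξ)) ρ) ∧
    -- The one-to-one correspondence, up to equivalence
    (∃ Φ : Quotient (coverSetoid n) ≃ Quotient (distSetoid n),
      (∀ (Θ : Cover n) (ρ : RegularDist n), ρ.1 = inducedDist Θ.1 → Φ ⟦Θ⟧ = ⟦ρ⟧) ∧
      (∀ (ρ : RegularDist n) (Ξ : Cover n) (ξ : E n → ℝ → Set (E n)),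
        IsCorrespondingFamily ρ.1 ξ → Ξ.1 = byScale ξ → Φ.symm ⟦ρ⟧ = ⟦Ξ⟧)) := by
  refine ⟨fun Θ hΘ => ?_, fun ρ hρ hconv hA => ⟨hconv.exists_correspondingFamily, fun ξ hξ =>
    ⟨hξ.isContinuousCover hρ hA, hξ.distEquiv hρ hA⟩⟩, coverEquivDist n, fun Θ ρ h => ?_,
    fun ρ Ξ ξ hξ h => ?_⟩
  · obtain ⟨M, a₁, a₂, a₃, a₄, a₅, a₆, hb⟩ := hΘ.exists_bounds
    exact ⟨hb.isQuasiDist, hb.isQuasiConvex, hb.nullMeasurableSet_qball, hb.isAhlforsRegular⟩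
  · exact congrArg _ (Subtype.ext h.symm : Θ.toDist = ρ)
  · refine Quotient.sound (CoverEquiv.symm ?_)
    rw [h]
    exact RegularDist.coverEquiv_toCover hξ (DistEquiv.refl ρ.1)
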